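/- Let $\mathcal S$ be an operator system, i.e. a norm-closed self-adjoint linear subspace of a unital C*-algebra $\mathfrak A$ that contains the unit of $\mathfrak A$, and let $\mathrm C^*(\mathcal S)\subseteq\mathfrak A$ be the C*-algebra it generates. A linear map $\varphi:\mathcal S\to\mathcal B(H)$ is completely positive (c.p.) if for all $n\ge 1$ the map $[s_{ij}]\mapsto[\varphi(s_{ij})]$ sends the positive matrices in $M_n(\mathcal S)\subseteq M_n(\mathfrak A)$ to positive elements of $M_n(\mathcal B(H))$, and u.c.p. if moreover $\varphi(1)=I$; likewise for maps on $\mathrm C^*(\mathcal S)$. A c.p. map $\varphi$ is pure if every c.p. map $\tau$ for which $\varphi-\tau$ is c.p. is a scalar multiple of $\varphi$. A dilation of a u.c.p. map $\varphi:\mathcal S\to\mathcal B(H)$ is a u.c.p. map $\psi:\mathcal S\to\mathcal B(K)$, with $K$ a Hilbert space containing $H$, such that $P_H\psi(s)|_H=\varphi(s)$ for all $s\in\mathcal S$; $\varphi$ is maximal if every dilation $\psi$ of $\varphi$ is a direct sum $\psi=\varphi\oplus\psi'$ with respect to $K=H\oplus H^\perp$. A unital $*$-representation $\pi:\mathrm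 C^*(\mathcal S)\to\mathcal B(K)$ is a boundary representation of $\mathcal S$ if it is irreducible ($K\neq 0$ and the only closed $\pi$-invariant subspaces are $0$ and $K$) and $\pi$ is the only u.c.p. map $\mathrm C^*(\mathcal S)\to\mathcal B(K)$ extending $\pi|_{\mathcal S}$. **Theorem.** Let $\mathcal S$ be an operator system, $H\neq 0$ a (complex) Hilbert space, and $\varphi:\mathcal S\to\mathcal B(H)$ a pure u.c.p. map. Then there are a Hilbert space $K\supseteq H$ and a dilation $\psi:\mathcal S\to\mathcal B(K)$ of $\varphi$ that is pure and maximal and that extends to a $*$-representation of $\mathrm C^*(\mathcal S)$ which is a boundary representation of $\mathcal S$. -/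

import Mathlib

open scoped CStarAlgebra

universe u v

/-- A (concrete) operator system in a unital C⋆-algebra `A`: a norm-closed self-adjoint subspace
containing the unit. -/
structure IsOperatorSystem {A : Type u} [CStarAlgebra A] (S : Submodule ℂ A) : Prop where
  one_mem : (1 : A) ∈ S
  star_mem : ∀ a ∈ S, star a ∈ S
  isClosed : IsClosed (S : Set A)

/-- `C⋆(S)`: the C⋆-subalgebra of `A` generated by `S` (and the unit of `A`). -/
noncomputable def cstarGenerated {A : Type u} [CStarAlgebra A] (S : Submodule ℂ A) :
    StarSubalgebra ℂ A :=
  (StarAlgebra.adjoin ℂ (S : Set A)).topologicalClosure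

theorem subset_cstarGenerated {A : Type u} [CStarAlgebra A] (S : Submodule ℂ A) {a : A}
    (ha : a ∈ S) : a ∈ cstarGenerated S :=
  StarSubalgebra.le_topologicalClosure _ (StarAlgebra.subset_adjoin ℂ (S : Set A) ha)

/-- `C⋆(S)` regarded as a linear subspace of `A`. -/
noncomputable def cstarSubspace {A : Type u} [CStarAlgebra A] (S : Submodule ℂ A) :
    Submodule ℂ A :=
  Subalgebra.toSubmodule (cstarGenerated S).toSubalgebra

/-- A linear map `φ` from a subspace `S` of the C⋆-algebra `A` to the operators on `H` is
completely positive if, for all `n`, it maps the matrices in `Mₙ(S)` that are positive in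
`Mₙ(A)` to positive elements of `Mₙ(B(H))`. -/
def IsCP {A : Type u} [CStarAlgebra A] [PartialOrder A] [StarOrderedRing A]
    {S : Submodule ℂ A} {H : Type v} [NormedAddCommGroup H] [InnerProductSpace ℂ H]
    [CompleteSpace H] (φ : S →ₗ[ℂ] (H →L[ℂ] H)) : Prop :=
  ∀ (n : ℕ) (X : CStarMatrix (Fin n) (Fin n) S),
    0 ≤ X.map (fun s : S => (s : A)) → 0 ≤ X.map (fun s : S => φ s)

/-- Unital completely positive maps. -/
def IsUCP {A : Type u} [CStarAlgebra A] [PartialOrder A] [StarOrderedRing A]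
    {S : Submodule ℂ A} {H : Type v} [NormedAddCommGroup H] [InnerProductSpace ℂ H]
    [CompleteSpace H] (φ : S →ₗ[ℂ] (H →L[ℂ] H)) : Prop :=
  IsCP φ ∧ ∃ h : (1 : A) ∈ S, φ ⟨1, h⟩ = 1

/-- A completely positive map `φ` is pure if the only completely positive maps `τ` with
`0 ≤ τ ≤ φ` (i.e. such that `φ - τ` is completely positive too) are scalar multiples of `φ`. -/
def IsPure {A : Type u} [CStarAlgebra A] [PartialOrder A] [StarOrderedRing A]
    {S : Submodule ℂ A} {H : Type v} [NormedAddCommGroup H] [InnerProductSpace ℂ H]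
    [CompleteSpace H] (φ : S →ₗ[ℂ] (H →L[ℂ] H)) : Prop :=
  IsCP φ ∧ ∀ τ : S →ₗ[ℂ] (H →L[ℂ] H), IsCP τ → IsCP (φ - τ) → ∃ t : ℂ, τ = t • φ

/-- `ψ : S → B(K)` is a dilation of `φ : S → B(H)`, where `H` is regarded as a subspace of `K`
through the isometry `V`: `ψ` is u.c.p. and its compression to `H` is `φ`. -/
def IsDilation {A : Type u} [CStarAlgebra A] [PartialOrder A] [StarOrderedRing A]
    {S : Submodule ℂ A} {H : Type v} [NormedAddCommGroup H] [InnerProductSpace ℂ H]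
    [CompleteSpace H] {K : Type*} [NormedAddCommGroup K] [InnerProductSpace ℂ K]
    [CompleteSpace K] (V : H →ₗᵢ[ℂ] K) (φ : S →ₗ[ℂ] (H →L[ℂ] H))
    (ψ : S →ₗ[ℂ] (K →L[ℂ] K)) : Prop :=
  IsUCP ψ ∧ ∀ s : S, (ContinuousLinearMap.adjoint V.toContinuousLinearMap) ∘L (ψ s) ∘L
    V.toContinuousLinearMap = φ s

/-- `φ` is maximal if each of its dilations `ψ` is of the form `φ ⊕ ψ'`, with respect to the
decomposition of the larger space as `H ⊕ Hᗮ`. It makes no difference in which universe the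
larger spaces `K` are taken: a dilation that is not of this form has a compression to the span
of `H` and one further vector that is not of this form either. -/
def IsMaximal {A : Type u} [CStarAlgebra A] [PartialOrder A] [StarOrderedRing A]
    {S : Submodule ℂ A} {H : Type v} [NormedAddCommGroup H] [InnerProductSpace ℂ H]
    [CompleteSpace H] (φ : S →ₗ[ℂ] (H →L[ℂ] H)) : Prop :=
  ∀ (K : Type v) [NormedAddCommGroup K] [InnerProductSpace ℂ K] [CompleteSpace K]
    (V : H →ₗᵢ[ℂ] K) (ψ : S →ₗ[ℂ] (K →L[ℂ] K)), IsDilation V φ ψ →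
    ∃ ψ' : S →ₗ[ℂ] ((LinearMap.range V.toLinearMap)ᗮ →L[ℂ] (LinearMap.range V.toLinearMap)ᗮ),
      ∀ (s : S) (x : H) (y : (LinearMap.range V.toLinearMap)ᗮ),
        ψ s (V x + (y : K)) = V (φ s x) + (ψ' s y : K)

/-- A unital ⋆-representation on `K` is irreducible if `K ≠ 0` and the only closed subspaces
of `K` that are invariant under all its operators are `0` and `K`. -/
def IsIrreducibleRep {B : Type u} [Ring B] [StarRing B] [Algebra ℂ B]
    {K : Type v} [NormedAddCommGroup K] [InnerProductSpace ℂ K] [CompleteSpace K]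
    (π : B →⋆ₐ[ℂ] (K →L[ℂ] K)) : Prop :=
  Nontrivial K ∧ ∀ M : Submodule ℂ K, IsClosed (M : Set K) →
    (∀ (b : B), ∀ x ∈ M, π b x ∈ M) → M = ⊥ ∨ M = ⊤

/-- A ⋆-representation `π` of `C⋆(S)` is a boundary representation of `S` if it is irreducible
and is the only u.c.p. map on `C⋆(S)` that extends the restriction of `π` to `S`. -/
def IsBoundaryRep {A : Type u} [CStarAlgebra A] [PartialOrder A] [StarOrderedRing A]
    (S : Submodule ℂ A) {K : Type v} [NormedAddCommGroup K] [InnerProductSpace ℂ K]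
    [CompleteSpace K] (π : cstarGenerated S →⋆ₐ[ℂ] (K →L[ℂ] K)) : Prop :=
  IsIrreducibleRep π ∧
    ∀ θ : cstarSubspace S →ₗ[ℂ] (K →L[ℂ] K), IsUCP θ →
      (∀ (a : A) (ha : a ∈ S),
        θ ⟨a, subset_cstarGenerated S ha⟩ = π ⟨a, subset_cstarGenerated S ha⟩) →
      ∀ (a : A) (ha : a ∈ cstarGenerated S), θ ⟨a, ha⟩ = π ⟨a, ha⟩

open scoped ComplexOrder InnerProductSpace

/-! A u.c.p. map on a closed subspace of a Hilbert space `L` is encoded as a c.p. map `ψ` on all of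
`L` whose value at the unit is the projection onto that subspace. Then `compress (ψ hS.one) ψ' = ψ`
says that `ψ'` dilates `ψ`. In one fixed `L`, weak ultrafilter limits of chains of pure maps are
pure (`exists_pure_upper_bound`), so Zorn's lemma yields a pure dilation `ψ` of `φ` with no proper
pure dilation in `L`.

The heart is `exists_pure_oneStepDilation`: a pure `ψ` with a nontrivial dilation by one dimension
`e` has a pure one. Among the dilations `χ` to the range of `ψ(1)` plus `ℂe`, a compact set, one
maximises `Re ⟪e, χ(s₀) x₀⟫` and takes an extreme point of the set of maximisers. If `χ = τ + σ`,
purity of `ψ` makes the compressions of `τ`, `σ` equal to `lψ`, `mψ` with `l + m = 1`. Renormalising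
the summands by a Schur complement and using the maximum shows that, for `l, m > 0`, `l⁻¹τ` and
`m⁻¹σ` are maximisers too, so `τ = lχ`.

A pure unital map is irreducible, which bounds the size of its space; if `L` is larger, a unit
vector `e` orthogonal to the range of `ψ(1)` remains. If `ψ` were not maximal on that range, a
nontrivial dilation would give one along `e`, hence a pure one, contradicting the choice of `ψ`.

By the theorems of Arveson and Stinespring, any u.c.p. extension of a maximal map to `C⋆(S)` is a
compression of a representation; maximality makes the subspace invariant, so the extension is
multiplicative and therefore unique. Purity gives irreducibility (`exists_boundaryRep`). -/

theorem CStarAlgebra.exists_eq_star_mul_self_of_nonneg {C : Type*} [CStarAlgebra C]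
    [PartialOrder C] [StarOrderedRing C] {a : C} (ha : 0 ≤ a) : ∃ b : C, a = star b * b :=
  CStarAlgebra.nonneg_iff_eq_star_mul_self.mp ha

/-! ### Positivity of operator matrices as positivity of scalar forms. -/

section MatrixForm

variable {H : Type*} [NormedAddCommGroup H] [InnerProductSpace ℂ H] {n : ℕ}

/-- The operator on `Hⁿ` given by a matrix of operators on `H`. -/
noncomputable def operatorOfMatrix (X : CStarMatrix (Fin n) (Fin n) (H →L[ℂ] H)) :
    PiLp 2 (fun _ : Fin n => H) →L[ℂ] PiLp 2 (fun _ : Fin n => H) :=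
  ((PiLp.continuousLinearEquiv 2 ℂ (fun _ : Fin n => H)).symm :
      (Fin n → H) →L[ℂ] PiLp 2 (fun _ : Fin n => H)) ∘L
    ContinuousLinearMap.pi fun i => ∑ j, X i j ∘L PiLp.proj 2 (fun _ : Fin n => H) j

theorem operatorOfMatrix_apply (X : CStarMatrix (Fin n) (Fin n) (H →L[ℂ] H))
    (h : PiLp 2 (fun _ : Fin n => H)) (i : Fin n) :
    operatorOfMatrix X h i = ∑ j, X i j (h j) := by
  simp [operatorOfMatrix]

theorem inner_operatorOfMatrix (X : CStarMatrix (Fin n) (Fin n) (H →L[ℂ] H))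
    (h k : PiLp 2 (fun _ : Fin n => H)) :
    ⟪h, operatorOfMatrix X k⟫_ℂ = ∑ i, ∑ j, ⟪h i, X i j (k j)⟫_ℂ := by
  simp [PiLp.inner_apply, operatorOfMatrix_apply, inner_sum]

variable [CompleteSpace H]

theorem CStarMatrix.form_nonneg {X : CStarMatrix (Fin n) (Fin n) (H →L[ℂ] H)} (hX : 0 ≤ X)
    (h : Fin n → H) : 0 ≤ ∑ i, ∑ j, ⟪h i, X i j (h j)⟫_ℂ := by
  obtain ⟨Y, rfl⟩ := CStarAlgebra.exists_eq_star_mul_self_of_nonneg hX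
  have : ∑ i, ∑ j, ⟪h i, (star Y * Y) i j (h j)⟫_ℂ
      = ∑ k, ⟪∑ i, Y k i (h i), ∑ j, Y k j (h j)⟫_ℂ := by
    simp only [CStarMatrix.mul_apply, CStarMatrix.star_apply, sum_inner, inner_sum,
      _root_.sum_apply, mul_apply_eq_comp,
      ContinuousLinearMap.star_eq_adjoint, ContinuousLinearMap.adjoint_inner_right]
    calc _ = ∑ i, ∑ k, ∑ j, ⟪Y k i (h i), Y k j (h j)⟫_ℂ :=
          Finset.sum_congr rfl fun i _ => Finset.sum_comm
      _ = ∑ k, ∑ i, ∑ j, ⟪Y k i (h i), Y k j (h j)⟫_ℂ := Finset.sum_comm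
      _ = _ := Finset.sum_congr rfl fun i _ => Finset.sum_comm
  rw [this]
  refine Finset.sum_nonneg fun k _ => ?_
  rw [inner_self_eq_norm_sq_to_K]
  norm_cast
  positivity

/-- The matrix acts on `Hⁿ` as a positive operator `R⋆R`; cutting `R` into blocks factors the matrix
itself. With the converse, this reduces complete positivity to scalar inequalities, which visibly
survive compressions and weak limits. -/
theorem CStarMatrix.nonneg_of_form {X : CStarMatrix (Fin n) (Fin n) (H →L[ℂ] H)}
    (hX : ∀ h : Fin n → H, 0 ≤ ∑ i, ∑ j, ⟪h i, X i j (h j)⟫_ℂ) : 0 ≤ X := by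
  have hpos : 0 ≤ operatorOfMatrix X := by
    rw [ContinuousLinearMap.nonneg_iff_isPositive, ContinuousLinearMap.isPositive_iff_complex]
    intro h
    have h0 := hX h
    rw [← inner_operatorOfMatrix] at h0
    rw [← inner_conj_symm, (RCLike.conj_eq_iff_im.mpr ?_)]
    · exact ⟨(Complex.ext (by simp) (by simpa using (Complex.le_def.mp h0).2)),
        (Complex.le_def.mp h0).1⟩
    · exact (Complex.le_def.mp h0).2.symm
  obtain ⟨R, hR⟩ := CStarAlgebra.exists_eq_star_mul_self_of_nonneg hpos
  let ι : Fin n → H →L[ℂ] PiLp 2 (fun _ : Fin n => H) := fun j =>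
    ((PiLp.continuousLinearEquiv 2 ℂ (fun _ : Fin n => H)).symm :
      (Fin n → H) →L[ℂ] PiLp 2 (fun _ : Fin n => H)) ∘L
      ContinuousLinearMap.single ℂ (fun _ : Fin n => H) j
  let Y : CStarMatrix (Fin n) (Fin n) (H →L[ℂ] H) := CStarMatrix.ofMatrix fun k j =>
    PiLp.proj 2 (fun _ : Fin n => H) k ∘L R ∘L ι j
  suffices X = star Y * Y from this ▸ star_mul_self_nonneg Y
  refine CStarMatrix.ext fun i j => ?_
  refine ContinuousLinearMap.ext fun y => ext_inner_left ℂ fun x => ?_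
  have h1 : ⟪ι i x, operatorOfMatrix X (ι j y)⟫_ℂ = ⟪x, X i j y⟫_ℂ := by
    rw [inner_operatorOfMatrix, Finset.sum_eq_single i, Finset.sum_eq_single j]
    · simp [ι]
    · intro b _ hb; simp [ι, hb]
    · simp
    · intro b _ hb; simp [ι, hb]
    · simp
  rw [← h1, hR, mul_apply_eq_comp, ContinuousLinearMap.star_eq_adjoint,
    ContinuousLinearMap.adjoint_inner_right, PiLp.inner_apply]
  simp only [mul_apply_eq_comp, ContinuousLinearMap.star_eq_adjoint,
    ContinuousLinearMap.adjoint_inner_right, CStarMatrix.mul_apply,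
    CStarMatrix.star_apply, _root_.sum_apply, inner_sum]
  rfl

end MatrixForm

section CP

variable {A : Type u} [CStarAlgebra A] [PartialOrder A] [StarOrderedRing A]
  {S : Submodule ℂ A} {H : Type v} [NormedAddCommGroup H] [InnerProductSpace ℂ H]
  [CompleteSpace H]

theorem isCP_iff_form {φ : S →ₗ[ℂ] (H →L[ℂ] H)} :
    IsCP φ ↔ ∀ (n : ℕ) (X : CStarMatrix (Fin n) (Fin n) S),
      0 ≤ X.map (fun s : S => (s : A)) → ∀ h : Fin n → H,
      0 ≤ ∑ i, ∑ j, ⟪h i, φ (X i j) (h j)⟫_ℂ :=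
  ⟨fun hφ n X hX h => CStarMatrix.form_nonneg (hφ n X hX) h,
    fun hφ n X hX => CStarMatrix.nonneg_of_form fun h => hφ n X hX h⟩

end CP

/-! ### Compressions `V⋆ φ(·) V`. -/

section Compress

variable {E H K G : Type*} [AddCommGroup E] [Module ℂ E]
  [NormedAddCommGroup H] [InnerProductSpace ℂ H] [CompleteSpace H]
  [NormedAddCommGroup K] [InnerProductSpace ℂ K] [CompleteSpace K]
  [NormedAddCommGroup G] [InnerProductSpace ℂ G] [CompleteSpace G]

/-- The map `s ↦ V⋆ φ(s) V`. -/
noncomputable def compress (V : K →L[ℂ] H) (φ : E →ₗ[ℂ] (H →L[ℂ] H)) :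
    E →ₗ[ℂ] (K →L[ℂ] K) where
  toFun s := ContinuousLinearMap.adjoint V ∘L φ s ∘L V
  map_add' s t := by ext; simp
  map_smul' c s := by ext; simp

theorem compress_apply (V : K →L[ℂ] H) (φ : E →ₗ[ℂ] (H →L[ℂ] H)) (s : E) :
    compress V φ s = ContinuousLinearMap.adjoint V ∘L φ s ∘L V := rfl

theorem inner_compress (V : K →L[ℂ] H) (φ : E →ₗ[ℂ] (H →L[ℂ] H)) (s : E) (x y : K) :
    ⟪x, compress V φ s y⟫_ℂ = ⟪V x, φ s (V y)⟫_ℂ := by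
  simp [compress_apply, ContinuousLinearMap.adjoint_inner_right]

omit [CompleteSpace H] in
theorem ext_inner_form {φ ψ : E →ₗ[ℂ] (H →L[ℂ] H)}
    (h : ∀ s x y, ⟪x, φ s y⟫_ℂ = ⟪x, ψ s y⟫_ℂ) : φ = ψ :=
  LinearMap.ext fun s => ContinuousLinearMap.ext fun y => ext_inner_left ℂ fun x => h s x y

theorem compress_compress (W : G →L[ℂ] K) (V : K →L[ℂ] H) (φ : E →ₗ[ℂ] (H →L[ℂ] H)) :
    compress W (compress V φ) = compress (V ∘L W) φ :=
  ext_inner_form fun s x y => by simp [inner_compress]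

theorem compress_id (φ : E →ₗ[ℂ] (H →L[ℂ] H)) :
    compress (ContinuousLinearMap.id ℂ H) φ = φ :=
  ext_inner_form fun s x y => by simp [inner_compress]

theorem compress_smul (V : K →L[ℂ] H) (c : ℂ) (φ : E →ₗ[ℂ] (H →L[ℂ] H)) :
    compress V (c • φ) = c • compress V φ :=
  ext_inner_form fun s x y => by simp [inner_compress]

theorem compress_sub (V : K →L[ℂ] H) (φ ψ : E →ₗ[ℂ] (H →L[ℂ] H)) :
    compress V (φ - ψ) = compress V φ - compress V ψ :=
  ext_inner_form fun s x y => by simp [inner_compress]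

theorem compress_add (V : K →L[ℂ] H) (φ ψ : E →ₗ[ℂ] (H →L[ℂ] H)) :
    compress V (φ + ψ) = compress V φ + compress V ψ :=
  ext_inner_form fun s x y => by simp [inner_compress]

end Compress

theorem CStarMatrix.ofMatrix_entry {m n A : Type*} (M : m → n → A) (i : m) (j : n) :
    CStarMatrix.ofMatrix M i j = M i j := rfl

/-! ### Cauchy–Schwarz for c.p. maps, and vectors null for `φ(1)`. -/

section CP

variable {A : Type u} [CStarAlgebra A] {S : Submodule ℂ A}

/-- The unit of `A` as an element of the operator system. -/
def IsOperatorSystem.one (hS : IsOperatorSystem S) : S := ⟨1, hS.one_mem⟩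

/-- The adjoint on an operator system. -/
def IsOperatorSystem.star (hS : IsOperatorSystem S) (s : S) : S :=
  ⟨Star.star (s : A), hS.star_mem s s.2⟩

theorem IsOperatorSystem.star_star (hS : IsOperatorSystem S) (s : S) :
    hS.star (hS.star s) = s := Subtype.ext (by simp [IsOperatorSystem.star])

variable [PartialOrder A] [StarOrderedRing A]
  {H : Type*} [NormedAddCommGroup H] [InnerProductSpace ℂ H] [CompleteSpace H]
  {K : Type*} [NormedAddCommGroup K] [InnerProductSpace ℂ K] [CompleteSpace K]

theorem IsCP.form_nonneg {φ : S →ₗ[ℂ] (H →L[ℂ] H)} (hφ : IsCP φ) {n : ℕ}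
    (X : CStarMatrix (Fin n) (Fin n) S) (hX : 0 ≤ X.map (fun s : S => (s : A)))
    (h : Fin n → H) : 0 ≤ ∑ i, ∑ j, ⟪h i, φ (X i j) (h j)⟫_ℂ :=
  isCP_iff_form.mp hφ n X hX h

theorem IsCP.compress {φ : S →ₗ[ℂ] (H →L[ℂ] H)} (hφ : IsCP φ) (V : K →L[ℂ] H) :
    IsCP (compress V φ) := by
  refine isCP_iff_form.mpr fun n X hX h => ?_
  simpa only [inner_compress] using hφ.form_nonneg X hX fun i => V (h i)

theorem IsCP.smul {φ : S →ₗ[ℂ] (H →L[ℂ] H)} (hφ : IsCP φ) {c : ℂ} (hc : 0 ≤ c) :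
    IsCP (c • φ) := by
  refine isCP_iff_form.mpr fun n X hX h => ?_
  simpa only [LinearMap.smul_apply, smul_apply, inner_smul_right, ← Finset.mul_sum]
    using mul_nonneg hc (hφ.form_nonneg X hX h)

theorem CStarMatrix.star_mul_nonneg {n : ℕ} (a : Fin n → A) :
    0 ≤ CStarMatrix.ofMatrix (fun i j => Star.star (a i) * a j) := by
  cases n with
  | zero => exact le_of_eq (CStarMatrix.ext fun i => i.elim0)
  | succ n =>
    let Y : CStarMatrix (Fin (n + 1)) (Fin (n + 1)) A :=
      CStarMatrix.ofMatrix fun k j => if k = 0 then a j else 0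
    suffices CStarMatrix.ofMatrix (fun i j => Star.star (a i) * a j) = Star.star Y * Y from
      this ▸ star_mul_self_nonneg Y
    refine CStarMatrix.ext fun i j => ?_
    rw [CStarMatrix.mul_apply, Finset.sum_eq_single 0]
    · simp [Y, CStarMatrix.ofMatrix_entry, CStarMatrix.star_apply]
    · intro b _ hb
      simp [Y, CStarMatrix.ofMatrix_entry, CStarMatrix.star_apply, hb]
    · simp

/-- The matrix is the rank-one matrix built from `(s⋆, 1)` plus the corner `‖s‖² - s s⋆ = b⋆b`. Its
entries lie in `S`, so a c.p. map may be applied to it. -/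
theorem IsOperatorSystem.matrix_nonneg (hS : IsOperatorSystem S) (s : S) :
    0 ≤ (CStarMatrix.ofMatrix (fun i j => (!![((‖s‖ ^ 2 : ℝ) : ℂ) • hS.one, s;
      hS.star s, hS.one] : Matrix (Fin 2) (Fin 2) S) i j)).map (fun s : S => (s : A)) := by
  have h1 : (s : A) * Star.star (s : A) ≤ algebraMap ℝ A (‖s‖ ^ 2) :=
    CStarAlgebra.mul_star_le_algebraMap_norm_sq
  obtain ⟨b, hb⟩ := CStarAlgebra.exists_eq_star_mul_self_of_nonneg (sub_nonneg.mpr h1)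
  have h2 := add_nonneg (CStarMatrix.star_mul_nonneg ![Star.star (s : A), 1])
    (CStarMatrix.star_mul_nonneg ![b, 0])
  convert! h2 using 1
  refine CStarMatrix.ext fun i j => ?_
  have h3 : (((‖s‖ ^ 2 : ℝ) : ℂ) • (1 : A)) = algebraMap ℝ A (‖s‖ ^ 2) := by
    rw [Algebra.algebraMap_eq_smul_one]; exact Complex.coe_smul _ _
  fin_cases i <;> fin_cases j
  · simpa [CStarMatrix.ofMatrix_entry, IsOperatorSystem.one, ← hb, IsOperatorSystem.star] using h3
  all_goals simp [CStarMatrix.ofMatrix_entry, IsOperatorSystem.one, IsOperatorSystem.star]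

variable {φ : S →ₗ[ℂ] (H →L[ℂ] H)}

theorem IsCP.two_form_nonneg (hS : IsOperatorSystem S) (hφ : IsCP φ) (s : S) (x y : H) :
    0 ≤ ((‖s‖ ^ 2 : ℝ) : ℂ) * ⟪x, φ hS.one x⟫_ℂ + ⟪x, φ s y⟫_ℂ
      + (⟪y, φ (hS.star s) x⟫_ℂ + ⟪y, φ hS.one y⟫_ℂ) := by
  have := hφ.form_nonneg _ (hS.matrix_nonneg s) ![x, y]
  simpa [CStarMatrix.ofMatrix_entry, Fin.sum_univ_two] using this

theorem IsCP.one_nonneg (hS : IsOperatorSystem S) (hφ : IsCP φ) (x : H) :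
    0 ≤ ⟪x, φ hS.one x⟫_ℂ := by
  simpa using hφ.two_form_nonneg hS 0 0 x

theorem IsCP.re_one_nonneg (hS : IsOperatorSystem S) (hφ : IsCP φ) (x : H) :
    0 ≤ (⟪x, φ hS.one x⟫_ℂ).re := (Complex.le_def.mp (hφ.one_nonneg hS x)).1

theorem IsCP.im_one (hS : IsOperatorSystem S) (hφ : IsCP φ) (x : H) :
    (⟪x, φ hS.one x⟫_ℂ).im = 0 := (Complex.le_def.mp (hφ.one_nonneg hS x)).2.symm

/-- The two-vector form is real at `(x, y)` and at `(x, iy)`; the two vanishing imaginary parts give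
the two components of the identity. -/
theorem IsCP.inner_star (hS : IsOperatorSystem S) (hφ : IsCP φ) (s : S) (x y : H) :
    ⟪y, φ (hS.star s) x⟫_ℂ = starRingEnd ℂ ⟪x, φ s y⟫_ℂ := by
  have h1 := (Complex.le_def.mp (hφ.two_form_nonneg hS s x y)).2
  have h2 := (Complex.le_def.mp (hφ.two_form_nonneg hS s x (Complex.I • y))).2
  have hx := hφ.im_one hS x
  have hy := hφ.im_one hS y
  simp only [inner_smul_left, inner_smul_right, map_smul, Complex.conj_I, Complex.add_im,
    Complex.mul_im, Complex.neg_im, Complex.neg_re, Complex.I_re, Complex.I_im, hx, hy,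
    Complex.mul_re, Complex.ofReal_im, Complex.ofReal_re, Complex.zero_im] at h1 h2
  apply Complex.ext
  · rw [Complex.conj_re]; linarith
  · rw [Complex.conj_im]; linarith

theorem IsCP.norm_inner_sq_le (hS : IsOperatorSystem S) (hφ : IsCP φ) (s : S) (x y : H) :
    ‖⟪x, φ s y⟫_ℂ‖ ^ 2
      ≤ ‖s‖ ^ 2 * (⟪x, φ hS.one x⟫_ℂ).re * (⟪y, φ hS.one y⟫_ℂ).re := by
  set z := ⟪x, φ s y⟫_ℂ with hz
  -- Replacing `y` by `-r z̄ y` aligns the phases, so that both cross terms become `-r‖z‖²`; the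
  -- bound is then a discriminant inequality.
  have key : ∀ r : ℝ, 0 ≤ (‖z‖ ^ 2 * (⟪y, φ hS.one y⟫_ℂ).re) * (r * r) + (-2 * ‖z‖ ^ 2) * r
      + ‖s‖ ^ 2 * (⟪x, φ hS.one x⟫_ℂ).re := by
    intro r
    have h := (Complex.le_def.mp
      (hφ.two_form_nonneg hS s x ((-(r : ℂ) * starRingEnd ℂ z) • y))).1
    have hy := hφ.im_one hS y
    have hx := hφ.im_one hS x
    simp only [inner_smul_left, inner_smul_right, map_smul, hφ.inner_star hS s, ← hz] at h
    rw [← Complex.normSq_eq_norm_sq, Complex.normSq_apply]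
    simp [Complex.add_re, Complex.mul_re, Complex.mul_im, hx, hy] at h
    convert! h using 1
    simp [← Complex.ofReal_pow]
    ring
  have hd := discrim_le_zero key
  rw [discrim] at hd
  rcases eq_or_ne (‖z‖) 0 with h0 | h0
  · rw [h0]
    have h1 := hφ.re_one_nonneg hS x
    have h2 := hφ.re_one_nonneg hS y
    rw [zero_pow two_ne_zero]
    exact mul_nonneg (mul_nonneg (sq_nonneg _) h1) h2
  · have hpos : 0 < ‖z‖ ^ 2 := by positivity
    by_contra hcon
    push Not at hcon
    nlinarith [mul_pos hpos (sub_pos.mpr hcon)]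

theorem IsCP.apply_eq_zero_of_null (hS : IsOperatorSystem S) (hφ : IsCP φ) {y : H}
    (hy : (⟪y, φ hS.one y⟫_ℂ).re ≤ 0) (s : S) : φ s y = 0 := by
  refine ext_inner_left ℂ fun x => ?_
  have h := hφ.norm_inner_sq_le hS s x y
  have hy' := le_antisymm hy (hφ.re_one_nonneg hS y)
  rw [hy', mul_zero] at h
  rw [inner_zero_right, ← norm_eq_zero]
  exact pow_eq_zero_iff two_ne_zero |>.mp (le_antisymm h (by positivity))

theorem IsCP.inner_eq_zero_of_null (hS : IsOperatorSystem S) (hφ : IsCP φ) {x : H}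
    (hx : (⟪x, φ hS.one x⟫_ℂ).re ≤ 0) (s : S) (y : H) : ⟪x, φ s y⟫_ℂ = 0 := by
  rw [← hS.star_star s, hφ.inner_star hS, hφ.apply_eq_zero_of_null hS hx, inner_zero_right,
    map_zero]

theorem IsCP.norm_inner_le (hS : IsOperatorSystem S) (hφ : IsCP φ)
    (h1 : ∀ x, (⟪x, φ hS.one x⟫_ℂ).re ≤ ‖x‖ ^ 2) (s : S) (x y : H) :
    ‖⟪x, φ s y⟫_ℂ‖ ≤ ‖s‖ * ‖x‖ * ‖y‖ := by
  refine le_of_sq_le_sq ?_ (by positivity)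
  have h2 : (⟪x, φ hS.one x⟫_ℂ).re * (⟪y, φ hS.one y⟫_ℂ).re ≤ ‖x‖ ^ 2 * ‖y‖ ^ 2 :=
    mul_le_mul (h1 x) (h1 y) (hφ.re_one_nonneg hS y) (by positivity)
  calc _ ≤ _ := hφ.norm_inner_sq_le hS s x y
    _ ≤ _ := by nlinarith [sq_nonneg ‖s‖, mul_le_mul_of_nonneg_left h2 (sq_nonneg ‖s‖)]

end CP

/-! ### Representations on completions, and the cone for the extension theorem. -/

section Representation

universe w

variable {A : Type u} [CStarAlgebra A] [PartialOrder A] [StarOrderedRing A]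

/-- Linearity is automatic: the squared norm of each defect of linearity expands into inner
products, which cancel as they do in `K`. -/
theorem exists_linearIsometry_of_inner {K L : Type*} [NormedAddCommGroup K]
    [InnerProductSpace ℂ K] [NormedAddCommGroup L] [InnerProductSpace ℂ L] (f : K → L)
    (hf : ∀ x y, ⟪f x, f y⟫_ℂ = ⟪x, y⟫_ℂ) : ∃ V : K →ₗᵢ[ℂ] L, ∀ x, V x = f x := by
  have hadd : ∀ x y, f (x + y) = f x + f y := fun x y => by
    rw [← sub_eq_zero, ← inner_self_eq_zero (𝕜 := ℂ)]
    simp only [inner_sub_left, inner_sub_right, inner_add_left, inner_add_right, hf]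
    ring
  have hsmul : ∀ (c : ℂ) x, f (c • x) = c • f x := fun c x => by
    rw [← sub_eq_zero, ← inner_self_eq_zero (𝕜 := ℂ)]
    simp only [inner_sub_left, inner_sub_right, inner_smul_left, inner_smul_right, hf]
    ring
  exact ⟨LinearMap.isometryOfInner ⟨⟨f, hadd⟩, hsmul⟩ hf, fun x => rfl⟩

/-- A ⋆-representation of `A` on a pre-Hilbert space by linear maps is automatically bounded and
extends to the completion. -/
theorem exists_rep_completion {V : Type w} [SeminormedAddCommGroup V] [InnerProductSpace ℂ V]
    (ρ : A →ₐ[ℂ] Module.End ℂ V)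
    (hρ : ∀ a v w, ⟪ρ a v, w⟫_ℂ = ⟪v, ρ (star a) w⟫_ℂ) :
    ∃ π : A →⋆ₐ[ℂ] (UniformSpace.Completion V →L[ℂ] UniformSpace.Completion V),
      ∀ a (v : V),
        π a (v : UniformSpace.Completion V) = ((ρ a v : V) : UniformSpace.Completion V) := by
  have hbound : ∀ a v, ‖ρ a v‖ ≤ ‖a‖ * ‖v‖ := by
    intro a v
    have h1 : star a * a ≤ algebraMap ℝ A (‖a‖ ^ 2) := CStarAlgebra.star_mul_le_algebraMap_norm_sq
    -- With `b⋆b = ‖a‖² - a⋆a`, the bound is the positivity of `‖ρ(b)v‖² = ‖a‖²‖v‖² - ‖ρ(a)v‖²`.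
    obtain ⟨b, hb⟩ := CStarAlgebra.exists_eq_star_mul_self_of_nonneg (sub_nonneg.mpr h1)
    have h3 : algebraMap ℝ A (‖a‖ ^ 2) = algebraMap ℂ A ((‖a‖ ^ 2 : ℝ) : ℂ) := by
      rw [Algebra.algebraMap_eq_smul_one, Algebra.algebraMap_eq_smul_one]
      exact (Complex.coe_smul _ _).symm
    have h2 : ⟪ρ b v, ρ b v⟫_ℂ = ((‖a‖ ^ 2 : ℝ) : ℂ) * ⟪v, v⟫_ℂ - ⟪ρ a v, ρ a v⟫_ℂ := by
      rw [hρ b, hρ a, ← Module.End.mul_apply, ← Module.End.mul_apply, ← map_mul, ← map_mul, ← hb,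
        map_sub, LinearMap.sub_apply, inner_sub_right, h3, AlgHom.commutes,
        Module.algebraMap_end_apply, inner_smul_right]
    simp only [inner_self_eq_norm_sq_to_K] at h2
    have h4 : ‖ρ b v‖ ^ 2 = ‖a‖ ^ 2 * ‖v‖ ^ 2 - ‖ρ a v‖ ^ 2 := by
      refine RCLike.ofReal_injective (K := ℂ) ?_
      push_cast
      simpa using h2
    refine le_of_sq_le_sq ?_ (by positivity)
    nlinarith [sq_nonneg ‖ρ b v‖]
  let σ : A → V →L[ℂ] V := fun a => (ρ a).mkContinuous ‖a‖ (hbound a)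
  have hσ : ∀ a (v : V), (σ a).completion (v : UniformSpace.Completion V)
      = ((ρ a v : V) : UniformSpace.Completion V) := fun a v => by
    simp [σ]
  refine ⟨{ toFun := fun a => (σ a).completion
            map_one' := ?_
            map_mul' := ?_
            map_zero' := ?_
            map_add' := ?_
            commutes' := ?_
            map_star' := ?_ }, hσ⟩
  · ext c
    induction c using UniformSpace.Completion.induction_on with
    | hp => exact isClosed_eq (by fun_prop) (by fun_prop)
    | ih c => simp [hσ]
  · intro a b
    ext c
    induction c using UniformSpace.Completion.induction_on with
    | hp => exact isClosed_eq (by fun_prop) (by fun_prop)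
    | ih c => simp [hσ]
  · ext c
    induction c using UniformSpace.Completion.induction_on with
    | hp => exact isClosed_eq (by fun_prop) (by fun_prop)
    | ih c => simp [hσ, UniformSpace.Completion.coe_zero]
  · intro a b
    ext c
    induction c using UniformSpace.Completion.induction_on with
    | hp => exact isClosed_eq (by fun_prop) (by fun_prop)
    | ih c => simp [hσ, UniformSpace.Completion.coe_add]
  · intro r
    ext c
    induction c using UniformSpace.Completion.induction_on with
    | hp => exact isClosed_eq (by fun_prop) (by fun_prop)
    | ih c => simp [hσ, Algebra.algebraMap_eq_smul_one]
  · intro a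
    refine (ContinuousLinearMap.eq_adjoint_iff _ _).mpr fun x y => ?_
    induction x, y using UniformSpace.Completion.induction_on₂ with
    | hp => exact isClosed_eq (by fun_prop) (by fun_prop)
    | ih x y => simp [hσ, hρ]

/-- The finitely supported matrix `f⋆ g`. -/
noncomputable def starMulMatrix {K : Type*} (f g : K →₀ A) : K × K →₀ A :=
  Finsupp.onFinset (f.support ×ˢ g.support) (fun p => star (f p.1) * g p.2) fun p hp => by
    simp only [Finset.mem_product, Finsupp.mem_support_iff]
    exact ⟨fun h => hp (by simp [h]), fun h => hp (by simp [h])⟩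

omit [PartialOrder A] [StarOrderedRing A] in
theorem starMulMatrix_apply {K : Type*} (f g : K →₀ A) (p : K × K) :
    starMulMatrix f g p = star (f p.1) * g p.2 := rfl

/-- The finitely supported matrices over `A` whose real part is positive. -/
noncomputable def accretiveCone (A : Type u) [CStarAlgebra A] [PartialOrder A]
    [StarOrderedRing A] (K : Type*) : PointedCone ℝ (K × K →₀ A) where
  carrier := {X | ∀ (n : ℕ) (v : Fin n → K),
    0 ≤ CStarMatrix.ofMatrix (fun i j => X (v i, v j) + star (X (v j, v i)))}
  add_mem' := by
    intro X Y hX hY n v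
    convert! add_nonneg (hX n v) (hY n v) using 1
    refine CStarMatrix.ext fun i j => ?_
    simp [CStarMatrix.ofMatrix_entry, add_add_add_comm]
  zero_mem' := by
    intro n v
    refine le_of_eq (CStarMatrix.ext fun i j => ?_)
    simp [CStarMatrix.ofMatrix_entry]
  smul_mem' := by
    intro c X hX n v
    convert! smul_nonneg c.2 (hX n v) using 1
    refine CStarMatrix.ext fun i j => ?_
    have h : star ((c : ℝ) • X (v j, v i)) = (c : ℝ) • star (X (v j, v i)) := by
      rw [star_smul, star_trivial]
    simpa [CStarMatrix.ofMatrix_entry, smul_add] using! h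

theorem starMulMatrix_mem_accretiveCone {K : Type*} (f : K →₀ A) :
    starMulMatrix f f ∈ accretiveCone A K := by
  intro n v
  have h := CStarMatrix.star_mul_nonneg fun i => f (v i)
  convert! add_nonneg h h using 1
  refine CStarMatrix.ext fun i j => ?_
  simp [CStarMatrix.ofMatrix_entry, starMulMatrix_apply]

/-- The negative of a skew matrix is skew, so a functional nonnegative on the cone vanishes on skew
matrices. This supplies the hermitian symmetry of the extended functional. -/
theorem mem_accretiveCone_of_skew {K : Type*} {X : K × K →₀ A}
    (hX : ∀ x y, star (X (y, x)) = - X (x, y)) : X ∈ accretiveCone A K := by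
  intro n v
  refine le_of_eq (CStarMatrix.ext fun i j => ?_)
  simp [CStarMatrix.ofMatrix_entry, hX]

/-- This is the domination condition of the Riesz extension theorem: the added diagonal matrix has
scalar entries, hence entries in `S`. The sum of this matrix and its adjoint splits into three
rank-one pieces, one of them built from `b⋆b = 2‖a‖² - a a⋆`. -/
theorem accretiveCone_single {K : Type*} (x y : K) (a : A) :
    (((‖a‖ ^ 2 : ℝ) : ℂ) • Finsupp.single (x, x) (1 : A) + Finsupp.single (y, y) 1)
      + Finsupp.single (x, y) a ∈ accretiveCone A K := by
  classical
  intro n v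
  have h1 : a * star a ≤ algebraMap ℝ A (‖a‖ ^ 2) := CStarAlgebra.mul_star_le_algebraMap_norm_sq
  have h2 : a * star a ≤ (2 : ℝ) • algebraMap ℝ A (‖a‖ ^ 2) := by
    rw [two_smul]
    exact le_add_of_le_of_nonneg h1 ((mul_star_self_nonneg a).trans h1)
  obtain ⟨b, hb⟩ := CStarAlgebra.exists_eq_star_mul_self_of_nonneg (sub_nonneg.mpr h2)
  let p : Fin n → ℂ := fun i => if v i = x then 1 else 0
  let q : Fin n → ℂ := fun i => if v i = y then 1 else 0
  have hp : ∀ i, star (p i) = p i := fun i => by by_cases h : v i = x <;> simp [p, h]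
  have hq : ∀ i, star (q i) = q i := fun i => by by_cases h : v i = y <;> simp [q, h]
  set c : ℂ := ((‖a‖ ^ 2 : ℝ) : ℂ) with hc
  have hcs : star c = c := Complex.conj_ofReal _
  have h3 : c • (1 : A) = algebraMap ℝ A (‖a‖ ^ 2) := by
    rw [Algebra.algebraMap_eq_smul_one]; exact Complex.coe_smul _ _
  have h4 : star b * b = c • (1 : A) + c • 1 - a * star a := by rw [h3, ← hb, two_smul]
  have hX : ∀ i j, ((c • Finsupp.single (x, x) (1 : A) + Finsupp.single (y, y) 1)
      + Finsupp.single (x, y) a : K × K →₀ A) (v i, v j)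
      = (c * (p i * p j)) • (1 : A) + (q i * q j) • (1 : A) + (p i * q j) • a := by
    intro i j
    simp only [Finsupp.add_apply, Finsupp.smul_apply, Finsupp.single_apply, Prod.mk.injEq, p, q,
      eq_comm (a := x), eq_comm (a := y)]
    congr 1
    · congr 1
      · by_cases h : v i = x <;> by_cases h' : v j = x <;> simp [h, h']
      · by_cases h : v i = y <;> by_cases h' : v j = y <;> simp [h, h']
    · by_cases h : v i = x <;> by_cases h' : v j = y <;> simp [h, h']
  have h := add_nonneg (add_nonneg
    (CStarMatrix.star_mul_nonneg fun i => p i • star a + q i • 1)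
    (CStarMatrix.star_mul_nonneg fun i => p i • b))
    (CStarMatrix.star_mul_nonneg fun i => q i • (1 : A))
  convert! h using 1
  refine CStarMatrix.ext fun i j => ?_
  simp only [CStarMatrix.ofMatrix_entry, CStarMatrix.add_apply, hX, star_add, star_smul, star_mul,
    hp, hq, hcs, star_one, star_star, add_mul, mul_add, smul_mul_smul_comm, h4, mul_one, one_mul]
  module

end Representation

/-! ### Arveson's extension theorem and Stinespring's theorem in one construction. -/

section Stinespring

universe w

variable {A : Type u} [CStarAlgebra A] [PartialOrder A] [StarOrderedRing A]
  {S : Submodule ℂ A} {K : Type w} [NormedAddCommGroup K] [InnerProductSpace ℂ K]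

/-- The functional `X ↦ ∑ ⟪x, θ(X x y) y⟫` on finitely supported matrices. -/
noncomputable def matrixFunctional (θ : A →ₗ[ℂ] (K →L[ℂ] K)) : (K × K →₀ A) →ₗ[ℂ] ℂ :=
  Finsupp.lsum ℂ fun p =>
    { toFun := fun a => ⟪p.1, θ a p.2⟫_ℂ
      map_add' := fun a b => by simp
      map_smul' := fun c a => by simp }

omit [PartialOrder A] [StarOrderedRing A] in
theorem matrixFunctional_single (θ : A →ₗ[ℂ] (K →L[ℂ] K)) (p : K × K) (a : A) :
    matrixFunctional θ (Finsupp.single p a) = ⟪p.1, θ a p.2⟫_ℂ := by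
  simp [matrixFunctional]

omit [PartialOrder A] [StarOrderedRing A] in
theorem matrixFunctional_eq_sum (θ : A →ₗ[ℂ] (K →L[ℂ] K)) (X : K × K →₀ A) :
    ∃ (n : ℕ) (v : Fin n → K),
      matrixFunctional θ X = ∑ i, ∑ j, ⟪v i, θ (X (v i, v j)) (v j)⟫_ℂ := by
  classical
  let J : Finset K := X.support.image Prod.fst ∪ X.support.image Prod.snd
  refine ⟨J.card, fun i => (J.equivFin.symm i : K), ?_⟩
  have hJ : X.support ⊆ J ×ˢ J := fun p hp => Finset.mem_product.mpr
    ⟨Finset.mem_union_left _ (Finset.mem_image_of_mem _ hp),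
      Finset.mem_union_right _ (Finset.mem_image_of_mem _ hp)⟩
  have h1 : matrixFunctional θ X = ∑ p ∈ J ×ˢ J, ⟪p.1, θ (X p) p.2⟫_ℂ := by
    rw [matrixFunctional, Finsupp.lsum_apply]
    exact Finsupp.sum_of_support_subset _ hJ _ (by simp)
  have h2 : ∀ g : K → ℂ, ∑ x ∈ J, g x = ∑ i, g (J.equivFin.symm i : K) := fun g => by
    rw [← Finset.sum_coe_sort]
    exact (Equiv.sum_comp J.equivFin.symm (fun x : J => g x)).symm
  rw [h1, Finset.sum_product, h2]
  exact Finset.sum_congr rfl fun i _ => h2 _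

/-- The finitely supported matrices with entries in `S`. -/
def matrixSubmodule (S : Submodule ℂ A) (K : Type*) : Submodule ℝ (K × K →₀ A) where
  carrier := {X | ∀ p, X p ∈ S}
  add_mem' hX hY p := S.add_mem (hX p) (hY p)
  zero_mem' p := S.zero_mem
  smul_mem' c X hX p := by
    have := S.smul_mem (c : ℂ) (hX p)
    rwa [Complex.coe_smul] at this

variable [CompleteSpace K]

theorem re_matrixFunctional_nonneg (hS : IsOperatorSystem S) {θ : S →ₗ[ℂ] (K →L[ℂ] K)}
    (hθ : IsCP θ) {θ' : A →ₗ[ℂ] (K →L[ℂ] K)} (hθ' : ∀ s : S, θ' s = θ s)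
    {X : K × K →₀ A} (hX : ∀ p, X p ∈ S) (hpos : X ∈ accretiveCone A K) :
    0 ≤ (matrixFunctional θ' X).re := by
  obtain ⟨n, v, hv⟩ := matrixFunctional_eq_sum θ' X
  let e : Fin n → Fin n → S := fun i j => ⟨X (v i, v j), hX _⟩
  have he : ∀ i j, X (v i, v j) = (e i j : A) := fun i j => rfl
  simp only [he, hθ'] at hv
  have h := hθ.form_nonneg (CStarMatrix.ofMatrix fun i j => e i j + hS.star (e j i)) (hpos n v) v
  simp only [CStarMatrix.ofMatrix_entry, map_add, add_apply, inner_add_right,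
    Finset.sum_add_distrib, hθ.inner_star hS] at h
  rw [Finset.sum_comm (f := fun i j => (starRingEnd ℂ) _)] at h
  simp only [← map_sum, ← hv] at h
  have := (Complex.le_def.mp h).1
  simp at this
  linarith

/-- Only the real part of `X ↦ ∑ ⟪x, θ(X x y) y⟫` is extended from `S`-matrices to `A`-matrices, by
the Riesz extension theorem, and then complexified. The resulting `G(f⋆g)` is directly Stinespring's
semi-inner product. -/
theorem exists_positive_extension (hS : IsOperatorSystem S) {θ : S →ₗ[ℂ] (K →L[ℂ] K)}
    (hθ : IsCP θ) : ∃ G : (K × K →₀ A) →ₗ[ℂ] ℂ,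
      (∀ (s : S) (x y : K), G (Finsupp.single (x, y) (s : A)) = ⟪x, θ s y⟫_ℂ) ∧
      (∀ f, 0 ≤ (G (starMulMatrix f f)).re) ∧
      ∀ f g, G (starMulMatrix g f) = starRingEnd ℂ (G (starMulMatrix f g)) := by
  -- This algebraic extension has no positivity; only its values on `S` matter.
  obtain ⟨θ', hθ'⟩ := LinearMap.exists_extend θ
  replace hθ' : ∀ s : S, θ' s = θ s := fun s => LinearMap.congr_fun hθ' s
  let F := matrixFunctional θ'
  let f : (K × K →₀ A) →ₗ.[ℝ] ℝ :=
    ⟨matrixSubmodule S K, (Complex.reLm ∘ₗ F.restrictScalars ℝ).domRestrict _⟩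
  obtain ⟨g, hgf, hg⟩ := riesz_extension (accretiveCone A K) f
    (fun X hX => re_matrixFunctional_nonneg hS hθ hθ' X.2 hX) (by
      intro Y
      induction Y using Finsupp.induction_linear with
      | zero => exact ⟨0, by simp⟩
      | add Y Z hY hZ =>
        obtain ⟨P, hP⟩ := hY
        obtain ⟨Q, hQ⟩ := hZ
        exact ⟨P + Q, by simpa [add_add_add_comm] using add_mem hP hQ⟩
      | single p a =>
        refine ⟨⟨_, ?_⟩, accretiveCone_single p.1 p.2 a⟩
        intro q
        classical
        simp only [Finsupp.add_apply, Finsupp.smul_apply, Finsupp.single_apply]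
        refine S.add_mem (S.smul_mem _ ?_) ?_ <;> split_ifs <;>
          first | exact hS.one_mem | exact S.zero_mem)
  have hskew : ∀ X : K × K →₀ A, (∀ x y, star (X (y, x)) = - X (x, y)) → g X = 0 := by
    intro X hX
    refine le_antisymm ?_ (hg X (mem_accretiveCone_of_skew hX))
    have := hg (-X) (mem_accretiveCone_of_skew fun x y => by simp [hX])
    simpa using this
  refine ⟨Module.Dual.extendRCLike (𝕜 := ℂ) g, ?_, ?_, ?_⟩
  · intro s x y
    have h1 : ∀ t : S, g (Finsupp.single (x, y) (t : A)) = (⟪x, θ t y⟫_ℂ).re := by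
      intro t
      have : Finsupp.single (x, y) (t : A) ∈ matrixSubmodule S K := by
        intro p
        classical
        rw [Finsupp.single_apply]
        split_ifs
        exacts [t.2, S.zero_mem]
      have h := hgf ⟨_, this⟩
      refine h.trans ?_
      change (F (Finsupp.single (x, y) (t : A))).re = _
      rw [matrixFunctional_single, hθ']
    have h2 := h1 (Complex.I • s)
    rw [Submodule.coe_smul, ← Finsupp.smul_single] at h2
    rw [Module.Dual.extendRCLike_apply, h1]
    erw [h2]
    apply Complex.ext <;> simp
  · intro h
    rw [Module.Dual.extendRCLike_apply]
    simpa using hg _ (starMulMatrix_mem_accretiveCone h)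
  · intro h k
    have e1 : g (starMulMatrix h k) = g (starMulMatrix k h) := by
      rw [← sub_eq_zero, ← map_sub]
      refine hskew _ fun x y => ?_
      simp [starMulMatrix_apply]
    have e2 : g (Complex.I • starMulMatrix h k) = - g (Complex.I • starMulMatrix k h) := by
      rw [← add_eq_zero_iff_eq_neg, ← map_add]
      refine hskew _ fun x y => ?_
      simp [starMulMatrix_apply, add_comm]
    rw [Module.Dual.extendRCLike_apply, Module.Dual.extendRCLike_apply, ← e1]
    apply Complex.ext
    · simp
    · simp [e2]

/-- Every u.c.p. map on an operator system is the compression of a ⋆-representation of the whole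
C⋆-algebra (Arveson's extension theorem together with Stinespring's theorem). -/
theorem exists_stinespring (hS : IsOperatorSystem S) {θ : S →ₗ[ℂ] (K →L[ℂ] K)}
    (hθ : IsCP θ) (h1 : θ hS.one = 1) :
    ∃ (L : Type (max u w)) (_ : NormedAddCommGroup L) (_ : InnerProductSpace ℂ L)
      (_ : CompleteSpace L) (V : K →ₗᵢ[ℂ] L) (π : A →⋆ₐ[ℂ] (L →L[ℂ] L)),
      ∀ (s : S) (x y : K), ⟪V x, π s (V y)⟫_ℂ = ⟪x, θ s y⟫_ℂ := by
  obtain ⟨G, hG, hpos, hsymm⟩ := exists_positive_extension hS hθ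
  let c : PreInnerProductSpace.Core ℂ (K →₀ A) :=
    { inner := fun f g => G (starMulMatrix f g)
      conj_inner_symm := fun f g => (hsymm g f).symm
      re_inner_nonneg := hpos
      add_left := fun f g h => by
        rw [← map_add]
        congr 1
        ext p
        simp [starMulMatrix_apply, add_mul]
      smul_left := fun f g r => by
        rw [← smul_eq_mul, ← map_smul]
        congr 1
        ext p
        simp [starMulMatrix_apply] }
  let : SeminormedAddCommGroup (K →₀ A) :=
    InnerProductSpace.Core.toSeminormedAddCommGroup (c := c)
  let : InnerProductSpace ℂ (K →₀ A) := InnerProductSpace.ofCore c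
  have hinner : ∀ f g : K →₀ A, ⟪f, g⟫_ℂ = G (starMulMatrix f g) := fun f g => rfl
  obtain ⟨π, hπ⟩ := exists_rep_completion (A := A)
    (Algebra.lsmul ℂ ℂ (K →₀ A)) (by
      intro a f g
      rw [hinner, hinner]
      congr 1
      ext p
      simp [starMulMatrix_apply, mul_assoc])
  have hsingle : ∀ (s : S) (x y : K),
      ⟪Finsupp.single x (1 : A), (s : A) • Finsupp.single y (1 : A)⟫_ℂ = ⟪x, θ s y⟫_ℂ := by
    intro s x y
    rw [hinner, ← hG]
    congr 1
    ext p
    classical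
    obtain ⟨p, q⟩ := p
    simp only [starMulMatrix_apply, Finsupp.smul_apply, Finsupp.single_apply, Prod.mk.injEq]
    by_cases hp : x = p <;> by_cases hq : y = q <;> simp [hp, hq]
  -- Finitely supported functions replace `A ⊗ K`, so `x ↦ single x 1` becomes linear only after
  -- null vectors are divided out in the completion.
  obtain ⟨V, hV⟩ := exists_linearIsometry_of_inner (K := K)
    (fun x => ((Finsupp.single x (1 : A) : K →₀ A) : UniformSpace.Completion (K →₀ A))) (by
      intro x y
      have := hsingle hS.one x y
      rw [h1] at this
      simpa [IsOperatorSystem.one] using this)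
  refine ⟨UniformSpace.Completion (K →₀ A), inferInstance, inferInstance, inferInstance, V, π,
    fun s x y => ?_⟩
  rw [hV, hV, hπ, UniformSpace.Completion.inner_coe]
  exact hsingle s x y

end Stinespring

/-! ### Weak limits and compactness. -/

section Limits

open Filter Topology

theorem exists_operator_of_form {L : Type*} [NormedAddCommGroup L] [InnerProductSpace ℂ L]
    [CompleteSpace L] (k : L → L → ℂ) (C : ℝ) (hk : ∀ x y, ‖k x y‖ ≤ C * ‖x‖ * ‖y‖)
    (hadd₁ : ∀ x x' y, k (x + x') y = k x y + k x' y)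
    (hsmul₁ : ∀ (c : ℂ) x y, k (c • x) y = starRingEnd ℂ c * k x y)
    (hadd₂ : ∀ x y y', k x (y + y') = k x y + k x y')
    (hsmul₂ : ∀ (c : ℂ) x y, k x (c • y) = c * k x y) :
    ∃ T : L →L[ℂ] L, ∀ x y, ⟪x, T y⟫_ℂ = k x y := by
  let B : L →L⋆[ℂ] L →L[ℂ] ℂ := LinearMap.mkContinuous₂
    (LinearMap.mk₂'ₛₗ (starRingEnd ℂ) (RingHom.id ℂ) k hadd₁ hsmul₁ hadd₂ hsmul₂) C hk
  refine ⟨ContinuousLinearMap.adjoint (InnerProductSpace.continuousLinearMapOfBilin B),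
    fun x y => ?_⟩
  rw [ContinuousLinearMap.adjoint_inner_right,
    InnerProductSpace.continuousLinearMapOfBilin_apply]
  rfl

variable {A : Type u} [CStarAlgebra A] [PartialOrder A] [StarOrderedRing A]
  {S : Submodule ℂ A} {L : Type*} [NormedAddCommGroup L] [InnerProductSpace ℂ L]
  [CompleteSpace L]

/-- Contractive completely positive maps have weak limits along ultrafilters. -/
theorem exists_ultralimit (hS : IsOperatorSystem S) {ι : Type*} (U : Ultrafilter ι)
    (ψ : ι → S →ₗ[ℂ] (L →L[ℂ] L)) (hcp : ∀ i, IsCP (ψ i))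
    (h1 : ∀ i x, (⟪x, ψ i hS.one x⟫_ℂ).re ≤ ‖x‖ ^ 2) :
    ∃ χ : S →ₗ[ℂ] (L →L[ℂ] L), IsCP χ ∧
      ∀ s x y, Tendsto (fun i => ⟪x, ψ i s y⟫_ℂ) U (𝓝 ⟪x, χ s y⟫_ℂ) := by
  have hlim : ∀ (s : S) (x y : L), ∃ z : ℂ, ‖z‖ ≤ ‖s‖ * ‖x‖ * ‖y‖ ∧
      Tendsto (fun i => ⟪x, ψ i s y⟫_ℂ) U (𝓝 z) := by
    intro s x y
    obtain ⟨z, hz, hz'⟩ := (isCompact_closedBall (0 : ℂ) (‖s‖ * ‖x‖ * ‖y‖)).ultrafilter_le_nhds'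
      (U.map fun i => ⟪x, ψ i s y⟫_ℂ) (by
        rw [Ultrafilter.mem_map]
        exact Filter.univ_mem' fun i => by
          simpa using (hcp i).norm_inner_le hS (h1 i) s x y)
    exact ⟨z, by simpa using hz, hz'⟩
  choose k hk hklim using hlim
  have huniq : ∀ {f : ι → ℂ} {a b : ℂ}, Tendsto f U (𝓝 a) → Tendsto f U (𝓝 b) → a = b :=
    fun ha hb => tendsto_nhds_unique ha hb
  have hT : ∀ s, ∃ T : L →L[ℂ] L, ∀ x y, ⟪x, T y⟫_ℂ = k s x y := by
    intro s
    refine exists_operator_of_form (k s) ‖s‖ (hk s) ?_ ?_ ?_ ?_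
    · intro x x' y
      refine huniq (hklim s _ _) ?_
      simpa only [inner_add_left] using (hklim s x y).add (hklim s x' y)
    · intro c x y
      refine huniq (hklim s _ _) ?_
      simpa only [inner_smul_left] using (hklim s x y).const_mul (starRingEnd ℂ c)
    · intro x y y'
      refine huniq (hklim s _ _) ?_
      simpa only [map_add, inner_add_right] using (hklim s x y).add (hklim s x y')
    · intro c x y
      refine huniq (hklim s _ _) ?_
      simpa only [map_smul, inner_smul_right] using (hklim s x y).const_mul c
  choose T hT using hT
  let χ : S →ₗ[ℂ] (L →L[ℂ] L) :=
    { toFun := T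
      map_add' := fun s t => ContinuousLinearMap.ext fun y => ext_inner_left ℂ fun x => by
        rw [add_apply, inner_add_right, hT, hT, hT]
        refine huniq (hklim _ _ _) ?_
        simpa only [map_add, add_apply, inner_add_right] using (hklim s x y).add (hklim t x y)
      map_smul' := fun c s => ContinuousLinearMap.ext fun y => ext_inner_left ℂ fun x => by
        rw [RingHom.id_apply, smul_apply, inner_smul_right, hT, hT]
        refine huniq (hklim _ _ _) ?_
        simpa only [map_smul, smul_apply, inner_smul_right] using (hklim s x y).const_mul c }
  have hχ : ∀ s x y, ⟪x, χ s y⟫_ℂ = k s x y := hT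
  refine ⟨χ, isCP_iff_form.mpr fun n X hX h => ?_, fun s x y => hχ s x y ▸ hklim s x y⟩
  simp only [hχ]
  have hsum : Tendsto (fun i => ∑ a, ∑ b, ⟪h a, ψ i (X a b) (h b)⟫_ℂ) U
      (𝓝 (∑ a, ∑ b, k (X a b) (h a) (h b))) :=
    tendsto_finsetSum _ fun a _ => tendsto_finsetSum _ fun b _ => hklim _ _ _
  exact ge_of_tendsto' hsum fun i => (hcp i).form_nonneg X hX h

/-- The matrix coefficients of an operator-valued map. -/
noncomputable def coefficients (ψ : S →ₗ[ℂ] (L →L[ℂ] L)) : S × L × L → ℂ :=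
  fun p => ⟪p.2.1, ψ p.1 p.2.2⟫_ℂ

omit [PartialOrder A] [StarOrderedRing A] [CompleteSpace L] in
theorem coefficients_injective :
    Function.Injective (coefficients : (S →ₗ[ℂ] (L →L[ℂ] L)) → S × L × L → ℂ) :=
  fun _ _ h => ext_inner_form fun s x y => congrFun h (s, x, y)

/-- The topology is the product topology on coefficients (the point-weak topology), where
ultrafilter limits exist by boundedness. Maximisation and the existence of extreme points are
applied to this image. -/
theorem isCompact_coefficients (hS : IsOperatorSystem S) (D : Set (S →ₗ[ℂ] (L →L[ℂ] L)))
    (hcp : ∀ ψ ∈ D, IsCP ψ) (h1 : ∀ ψ ∈ D, ∀ x, (⟪x, ψ hS.one x⟫_ℂ).re ≤ ‖x‖ ^ 2)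
    (hclosed : ∀ (U : Ultrafilter D) (χ : S →ₗ[ℂ] (L →L[ℂ] L)), IsCP χ →
      (∀ s x y, Tendsto (fun ψ : D => ⟪x, (ψ : S →ₗ[ℂ] (L →L[ℂ] L)) s y⟫_ℂ) U
        (𝓝 ⟪x, χ s y⟫_ℂ)) → χ ∈ D) :
    IsCompact (coefficients '' D) := by
  rw [isCompact_iff_ultrafilter_le_nhds]
  intro f hf
  have hinj : Function.Injective fun ψ : D => coefficients (ψ : S →ₗ[ℂ] (L →L[ℂ] L)) :=
    coefficients_injective.comp Subtype.val_injective
  have hrange : Set.range (fun ψ : D => coefficients (ψ : S →ₗ[ℂ] (L →L[ℂ] L))) ∈ f := by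
    have := Filter.le_principal_iff.mp hf
    rwa [Set.image_eq_range] at this
  let U : Ultrafilter D := f.comap hinj hrange
  obtain ⟨χ, hχ, hlim⟩ := exists_ultralimit hS U (fun ψ => (ψ : S →ₗ[ℂ] (L →L[ℂ] L)))
    (fun ψ => hcp ψ ψ.2) (fun ψ => h1 ψ ψ.2)
  refine ⟨coefficients χ, ⟨χ, hclosed U χ hχ hlim, rfl⟩, ?_⟩
  have hU : Tendsto (fun ψ : D => coefficients (ψ : S →ₗ[ℂ] (L →L[ℂ] L))) U
      (𝓝 (coefficients χ)) := tendsto_pi_nhds.mpr fun p => hlim p.1 p.2.1 p.2.2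
  refine le_trans (le_of_eq ?_) hU
  rw [Ultrafilter.coe_comap]
  exact (Filter.map_comap_of_mem hrange).symm

end Limits

/-! ### Dilations by one dimension. -/

section OneStep

variable {A : Type u} [CStarAlgebra A] [PartialOrder A] [StarOrderedRing A]
  {S : Submodule ℂ A} {L : Type*} [NormedAddCommGroup L] [InnerProductSpace ℂ L]
  [CompleteSpace L]

theorem IsCP.one_symm (hS : IsOperatorSystem S) {ψ : S →ₗ[ℂ] (L →L[ℂ] L)} (hψ : IsCP ψ)
    (x y : L) : ⟪ψ hS.one x, y⟫_ℂ = ⟪x, ψ hS.one y⟫_ℂ := by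
  have h : hS.star hS.one = hS.one := Subtype.ext (star_one A)
  rw [← inner_conj_symm, ← hψ.inner_star hS, h]

theorem IsCP.inner_one_eq_re (hS : IsOperatorSystem S) {ψ : S →ₗ[ℂ] (L →L[ℂ] L)} (hψ : IsCP ψ)
    (x : L) : ⟪x, ψ hS.one x⟫_ℂ = ((⟪x, ψ hS.one x⟫_ℂ).re : ℂ) :=
  Complex.ext (by simp) (by simpa using hψ.im_one hS x)

/-- The completely positive maps that dilate `ψ` by one further dimension, spanned by `e`. -/
def oneStepDilations (hS : IsOperatorSystem S) (ψ : S →ₗ[ℂ] (L →L[ℂ] L)) (e : L) :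
    Set (S →ₗ[ℂ] (L →L[ℂ] L)) :=
  {χ | IsCP χ ∧ (∀ x, χ hS.one x = ψ hS.one x + ⟪e, x⟫_ℂ • e) ∧ compress (ψ hS.one) χ = ψ}

variable {hS : IsOperatorSystem S} {ψ : S →ₗ[ℂ] (L →L[ℂ] L)} {e : L}

omit [PartialOrder A] [StarOrderedRing A] in
theorem inner_of_compress_eq_smul {τ : S →ₗ[ℂ] (L →L[ℂ] L)} {l : ℂ}
    (h : compress (ψ hS.one) τ = l • ψ) (s : S) {x y : L}
    (hx : ψ hS.one x = x) (hy : ψ hS.one y = y) : ⟪x, τ s y⟫_ℂ = l * ⟪x, ψ s y⟫_ℂ := by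
  have := inner_compress (ψ hS.one) τ s x y
  rw [hx, hy, h] at this
  simpa [inner_smul_right] using this.symm

/-- A map supported on `q = ψ(1) + e ⊗ e` is unchanged by precomposition with `q`. -/
theorem apply_eq_apply_of_support {τ : S →ₗ[ℂ] (L →L[ℂ] L)} (hτ : IsCP τ)
    (he : ‖e‖ = 1) (hpe : ψ hS.one e = 0) (hψ : IsCP ψ)
    (hidem : ∀ x, ψ hS.one (ψ hS.one x) = ψ hS.one x)
    (hsupp : ∀ x, ψ hS.one x = 0 → ⟪e, x⟫_ℂ = 0 → τ hS.one x = 0) (s : S) (y : L) :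
    τ s y = τ s (ψ hS.one y + ⟪e, y⟫_ℂ • e) := by
  rw [← sub_eq_zero, ← map_sub]
  refine hτ.apply_eq_zero_of_null hS ?_ s
  rw [hsupp _ _ _, inner_zero_right]
  · simp
  · simp [hidem, hpe]
  · rw [inner_sub_right, inner_add_right, ← hψ.one_symm hS, hpe, inner_smul_right,
      inner_self_eq_norm_sq_to_K, he]
    simp

theorem inner_eq_inner_of_support {τ : S →ₗ[ℂ] (L →L[ℂ] L)} (hτ : IsCP τ)
    (he : ‖e‖ = 1) (hpe : ψ hS.one e = 0) (hψ : IsCP ψ)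
    (hidem : ∀ x, ψ hS.one (ψ hS.one x) = ψ hS.one x)
    (hsupp : ∀ x, ψ hS.one x = 0 → ⟪e, x⟫_ℂ = 0 → τ hS.one x = 0) (s : S) (x y : L) :
    ⟪ψ hS.one x + ⟪e, x⟫_ℂ • e, τ s (ψ hS.one y + ⟪e, y⟫_ℂ • e)⟫_ℂ = ⟪x, τ s y⟫_ℂ := by
  rw [← apply_eq_apply_of_support hτ he hpe hψ hidem hsupp]
  refine (starRingEnd ℂ).injective ?_
  rw [← hτ.inner_star hS, ← hτ.inner_star hS,
    ← apply_eq_apply_of_support hτ he hpe hψ hidem hsupp]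

theorem eq_zero_of_support {τ : S →ₗ[ℂ] (L →L[ℂ] L)} (hτ : IsCP τ)
    (he : ‖e‖ = 1) (hpe : ψ hS.one e = 0) (hψ : IsCP ψ)
    (hidem : ∀ x, ψ hS.one (ψ hS.one x) = ψ hS.one x)
    (hsupp : ∀ x, ψ hS.one x = 0 → ⟪e, x⟫_ℂ = 0 → τ hS.one x = 0)
    (h0 : compress (ψ hS.one) τ = 0) (hα : (⟪e, τ hS.one e⟫_ℂ).re ≤ 0) : τ = 0 := by
  refine LinearMap.ext fun s => ContinuousLinearMap.ext fun y => ?_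
  have h1 : τ s (ψ hS.one y) = 0 := by
    refine hτ.apply_eq_zero_of_null hS ?_ s
    rw [inner_of_compress_eq_smul (l := 0) (by simpa using h0) _ (hidem y) (hidem y)]
    simp
  rw [apply_eq_apply_of_support hτ he hpe hψ hidem hsupp, map_add, h1, map_smul,
    hτ.apply_eq_zero_of_null hS hα]
  simp

/-- On the range of `p = ψ(1)` plus `ℂe`, `τ(1)` has diagonal blocks `lp`, `α = ⟪e, τ(1)e⟫` and
off-diagonal vector `lw`. Its Schur complement is `ld²`, and `e - w` is orthogonal to the range of
`p` for the form of `τ(1)`. Sending `e` to `d⁻¹(e - w)` turns `l⁻¹τ` into a one-step dilation, to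
which the bound `η` applies. -/
theorem oneStep_estimate {τ : S →ₗ[ℂ] (L →L[ℂ] L)} (hτ : IsCP τ)
    (he : ‖e‖ = 1) (hpe : ψ hS.one e = 0) (hψ : IsCP ψ)
    (hidem : ∀ x, ψ hS.one (ψ hS.one x) = ψ hS.one x)
    (hsupp : ∀ x, ψ hS.one x = 0 → ⟪e, x⟫_ℂ = 0 → τ hS.one x = 0)
    {l : ℝ} (hl : 0 ≤ l) (hτψ : compress (ψ hS.one) τ = (l : ℂ) • ψ)
    {s₀ : S} {x₀ : L} (hx₀ : ψ hS.one x₀ = x₀) {η : ℝ}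
    (hη : ∀ χ ∈ oneStepDilations hS ψ e, (⟪e, χ s₀ x₀⟫_ℂ).re ≤ η) :
    ∃ (w : L) (d : ℝ), l * (‖w‖ ^ 2 + d ^ 2) ≤ (⟪e, τ hS.one e⟫_ℂ).re ∧
      (⟪e, τ s₀ x₀⟫_ℂ).re ≤ (⟪ψ hS.one (τ hS.one e), ψ s₀ x₀⟫_ℂ).re + l * d * η ∧
      (d = 1 → w = 0 → 0 < l → ((l⁻¹ : ℝ) : ℂ) • τ ∈ oneStepDilations hS ψ e) := by
  have hF := fun s x y => inner_of_compress_eq_smul hτψ s (x := x) (y := y)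
  have hex : ∀ x, ⟪e, ψ hS.one x⟫_ℂ = 0 := fun x => by
    rw [← hψ.one_symm hS, hpe, inner_zero_left]
  rcases hl.eq_or_lt with rfl | hl
  · refine ⟨0, 0, by simpa using hτ.re_one_nonneg hS e, ?_, by simp⟩
    have h1 : ∀ x, ψ hS.one x = x → (⟪x, τ hS.one x⟫_ℂ).re ≤ 0 := fun x hx => by
      rw [hF _ _ _ hx hx]; simp
    have h2 : ψ hS.one (τ hS.one e) = 0 := ext_inner_left ℂ fun x => by
      rw [← hψ.one_symm hS, hτ.inner_eq_zero_of_null hS (h1 _ (hidem x)), inner_zero_right]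
    rw [hτ.apply_eq_zero_of_null hS (h1 _ hx₀), h2]
    simp
  · have hlC : (l : ℂ) ≠ 0 := by exact_mod_cast hl.ne'
    set w : L := ((l⁻¹ : ℝ) : ℂ) • ψ hS.one (τ hS.one e) with hw
    have hlw : (l : ℂ) • w = ψ hS.one (τ hS.one e) := by
      rw [hw, smul_smul]; simp [hlC]
    have hpw : ψ hS.one w = w := by rw [hw, map_smul, hidem]
    clear_value w
    have hpx : ∀ x, ψ hS.one x = x → ⟪x, τ hS.one (e - w)⟫_ℂ = 0 := fun x hx => by
      have : ⟪x, τ hS.one e⟫_ℂ = ⟪x, ψ hS.one (τ hS.one e)⟫_ℂ := by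
        rw [← hψ.one_symm hS, hx]
      rw [map_sub, inner_sub_right, this, hF _ _ _ hx hpw, hpw, ← hlw, inner_smul_right, sub_self]
    have hwe : ⟪w, τ hS.one e⟫_ℂ = ((l * ‖w‖ ^ 2 : ℝ) : ℂ) := by
      have h := hpx w hpw
      rw [map_sub, inner_sub_right, sub_eq_zero, hF _ _ _ hpw hpw, hpw,
        inner_self_eq_norm_sq_to_K] at h
      rw [h]; simp
    set β : ℝ := (⟪e, τ hS.one e⟫_ℂ).re - l * ‖w‖ ^ 2 with hβ
    have hu : ⟪e - w, τ hS.one (e - w)⟫_ℂ = (β : ℂ) := by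
      have h1 : ⟪e, τ hS.one w⟫_ℂ = ((l * ‖w‖ ^ 2 : ℝ) : ℂ) := by
        rw [← hτ.one_symm hS, ← inner_conj_symm, hwe, Complex.conj_ofReal]
      rw [inner_sub_left, hpx w hpw, map_sub, inner_sub_right, h1, hτ.inner_one_eq_re hS, hβ]
      simp
    have hβ0 : 0 ≤ β := by
      have := hτ.re_one_nonneg hS (e - w)
      rwa [hu, Complex.ofReal_re] at this
    set d : ℝ := Real.sqrt (β / l) with hd
    have hd2 : l * d ^ 2 = β := by
      rw [hd, Real.sq_sqrt (by positivity)]; field_simp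
    have hd0 : 0 ≤ d := Real.sqrt_nonneg _
    let C : L →L[ℂ] L := ψ hS.one + InnerProductSpace.rankOne ℂ (((d⁻¹ : ℝ) : ℂ) • (e - w)) e
    have hC : ∀ x, C x = ψ hS.one x + ⟪e, x⟫_ℂ • ((d⁻¹ : ℝ) : ℂ) • (e - w) := fun x => by
      simp only [C, add_apply, InnerProductSpace.rankOne_apply]
    have hCD : 0 < d → ((l⁻¹ : ℝ) : ℂ) • compress C τ ∈ oneStepDilations hS ψ e := by
      intro hdpos
      refine ⟨(hτ.compress C).smul (by simpa using hl.le), fun y => ext_inner_left ℂ fun x => ?_,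
        ext_inner_form fun s x y => ?_⟩
      · have h1 : ⟪e - w, τ hS.one (ψ hS.one y)⟫_ℂ = 0 := by
          rw [← hτ.one_symm hS, ← inner_conj_symm, hpx _ (hidem y), map_zero]
        rw [LinearMap.smul_apply, smul_apply, inner_smul_right, inner_compress, hC, hC]
        simp only [inner_add_left, inner_add_right, map_add, map_smul, inner_smul_left,
          inner_smul_right, h1, hpx _ (hidem x), hu, hF _ _ _ (hidem x) (hidem y), hidem]
        rw [hψ.one_symm hS, hidem, ← hd2, inner_conj_symm]
        have hdC : (d : ℂ) ≠ 0 := by exact_mod_cast hdpos.ne'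
        simp
        field_simp
      · have h1 : ∀ x, C (ψ hS.one x) = ψ hS.one x := fun x => by rw [hC, hex, hidem]; simp
        rw [inner_compress, LinearMap.smul_apply, smul_apply, inner_smul_right, inner_compress,
          h1, h1, ← inner_compress, hτψ, LinearMap.smul_apply, smul_apply, inner_smul_right]
        simp [hlC]
    refine ⟨w, d, le_of_eq ?_, ?_, ?_⟩
    · rw [mul_add, hd2, hβ]; ring
    · have h1 : ⟪e, τ s₀ x₀⟫_ℂ = ⟪e - w, τ s₀ x₀⟫_ℂ + ⟪ψ hS.one (τ hS.one e), ψ s₀ x₀⟫_ℂ := by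
        rw [inner_sub_left, hF _ _ _ hpw hx₀, ← hlw, inner_smul_left, Complex.conj_ofReal]
        ring
      have h2 : (⟪e - w, τ s₀ x₀⟫_ℂ).re ≤ l * d * η := by
        rcases hd0.eq_or_lt with h0 | hdpos
        · rw [hτ.inner_eq_zero_of_null hS, ← h0]
          · simp
          · rw [hu, ← hd2, ← h0]; simp
        · have h3 := hη _ (hCD hdpos)
          have h4 : C x₀ = x₀ := by
            rw [hC, hx₀, ← hx₀, hex]; simp
          have h5 : C e = ((d⁻¹ : ℝ) : ℂ) • (e - w) := by
            rw [hC, hpe, inner_self_eq_norm_sq_to_K, he]; simp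
          rw [LinearMap.smul_apply, smul_apply, inner_smul_right, inner_compress, h4, h5,
            inner_smul_left, Complex.conj_ofReal, Complex.re_ofReal_mul,
            Complex.re_ofReal_mul, inv_mul_le_iff₀ hl, inv_mul_le_iff₀ hdpos] at h3
          linarith
      rw [h1, Complex.add_re]
      linarith
    · intro hd1 hw0 _
      have h := hCD (by rw [hd1]; exact one_pos)
      suffices compress C τ = τ by rwa [this] at h
      refine ext_inner_form fun s x y => ?_
      have h6 : ∀ x, C x = ψ hS.one x + ⟪e, x⟫_ℂ • e := fun x => by rw [hC, hd1, hw0]; simp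
      rw [inner_compress, h6, h6]
      exact inner_eq_inner_of_support hτ he hpe hψ hidem hsupp s x y

end OneStep

/-! ### Existence of a pure dilation by one dimension. -/

section PureStep

open Filter Topology

variable {A : Type u} [CStarAlgebra A] [PartialOrder A] [StarOrderedRing A]
  {S : Submodule ℂ A} {L : Type*} [NormedAddCommGroup L] [InnerProductSpace ℂ L]
  [CompleteSpace L]

omit [CompleteSpace L] in
theorem inner_rankOne_add_le {p : L → L} (hidem : ∀ x, p (p x) = p x)
    (hsymm : ∀ x y, ⟪p x, y⟫_ℂ = ⟪x, p y⟫_ℂ) {e : L} (he : ‖e‖ = 1) (hpe : p e = 0) (x : L) :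
    (⟪x, p x + ⟪e, x⟫_ℂ • e⟫_ℂ).re ≤ ‖x‖ ^ 2 := by
  have h1 : ⟪e, x⟫_ℂ = ⟪e, x - p x⟫_ℂ := by
    rw [inner_sub_right, ← hsymm, hpe, inner_zero_left, sub_zero]
  have h2 : ⟪x, p x⟫_ℂ = ((‖p x‖ ^ 2 : ℝ) : ℂ) := by
    rw [← hidem, ← hsymm, inner_self_eq_norm_sq_to_K, hidem]; simp
  have h3 : ⟪p x, x - p x⟫_ℂ = 0 := by
    rw [inner_sub_right, hsymm x (p x), hidem, hsymm, sub_self]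
  have h4 : ‖x‖ ^ 2 = ‖p x‖ ^ 2 + ‖x - p x‖ ^ 2 := by
    have := norm_add_sq_eq_norm_sq_add_norm_sq_of_inner_eq_zero (p x) (x - p x) h3
    rw [add_sub_cancel] at this
    linarith [sq ‖x‖, sq ‖p x‖, sq ‖x - p x‖]
  have h5 : ‖⟪e, x⟫_ℂ‖ ≤ ‖x - p x‖ := by
    rw [h1]
    refine (norm_inner_le_norm (𝕜 := ℂ) e (x - p x)).trans (le_of_eq ?_)
    rw [he, one_mul]
  have h6 : ⟪e, x⟫_ℂ * ⟪x, e⟫_ℂ = ((‖⟪e, x⟫_ℂ‖ ^ 2 : ℝ) : ℂ) := by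
    rw [← inner_conj_symm x e, Complex.mul_conj, Complex.normSq_eq_norm_sq]
  rw [inner_add_right, inner_smul_right, h2, h6, h4, Complex.add_re, Complex.ofReal_re,
    Complex.ofReal_re]
  gcongr

variable {hS : IsOperatorSystem S} {ψ : S →ₗ[ℂ] (L →L[ℂ] L)} {e : L}

theorem isCompact_oneStepDilations (hψ : IsCP ψ)
    (hidem : ∀ x, ψ hS.one (ψ hS.one x) = ψ hS.one x) (he : ‖e‖ = 1) (hpe : ψ hS.one e = 0) :
    IsCompact (coefficients '' oneStepDilations hS ψ e) := by
  refine isCompact_coefficients hS _ (fun χ hχ => hχ.1) (fun χ hχ x => ?_) fun U χ hcp hlim => ?_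
  · rw [hχ.2.1]
    exact inner_rankOne_add_le hidem (hψ.one_symm hS) he hpe x
  · refine ⟨hcp, fun y => ext_inner_left ℂ fun x => ?_, ext_inner_form fun s x y => ?_⟩
    · refine tendsto_nhds_unique (hlim hS.one x y) ?_
      simp_rw [fun χ : oneStepDilations hS ψ e => χ.2.2.1 y]
      exact tendsto_const_nhds
    · rw [inner_compress]
      refine tendsto_nhds_unique (hlim s _ _) ?_
      simp_rw [← inner_compress, fun χ : oneStepDilations hS ψ e => χ.2.2.2]
      exact tendsto_const_nhds

theorem exists_smul_of_pure {p : L →L[ℂ] L} (hψ : IsPure ψ) {χ τ : S →ₗ[ℂ] (L →L[ℂ] L)}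
    (hχ : compress p χ = ψ) (hτ : IsCP τ) (hσ : IsCP (χ - τ)) (hS : IsOperatorSystem S)
    {x : L} (hx : 0 < (⟪x, ψ hS.one x⟫_ℂ).re) :
    ∃ l : ℝ, 0 ≤ l ∧ compress p τ = (l : ℂ) • ψ := by
  obtain ⟨t, ht⟩ := hψ.2 (compress p τ) (hτ.compress p) (by
    rw [← hχ, ← compress_sub]; exact hσ.compress p)
  have h := (hτ.compress p).one_nonneg hS x
  rw [ht, LinearMap.smul_apply, smul_apply, inner_smul_right, hψ.1.inner_one_eq_re hS] at h
  obtain ⟨h1, h2⟩ := Complex.le_def.mp h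
  simp only [Complex.mul_re, Complex.mul_im, Complex.ofReal_re, Complex.ofReal_im, mul_zero,
    sub_zero, zero_add, Complex.zero_re, Complex.zero_im] at h1 h2
  refine ⟨t.re, nonneg_of_mul_nonneg_left h1 hx, ?_⟩
  have h3 : t.im = 0 := by simpa [hx.ne'] using h2.symm
  rw [ht]
  congr 1
  exact Complex.ext (by simp) (by simp [h3])

/-- Expanding the squares, the two nonnegative quantities sum to at most `1 - 2 + 1 = 0`. -/
theorem weights_rigid {l m a a' d d' r r' : ℝ} (hl : 0 ≤ l) (hm : 0 ≤ m) (hlm : l + m = 1)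
    (haa : a + a' = 1) (ha : l * (r ^ 2 + d ^ 2) ≤ a) (ha' : m * (r' ^ 2 + d' ^ 2) ≤ a')
    (hd : 1 ≤ l * d + m * d') :
    l * ((d - 1) ^ 2 + r ^ 2) = 0 ∧ m * ((d' - 1) ^ 2 + r' ^ 2) = 0 := by
  have h1 : 0 ≤ l * ((d - 1) ^ 2 + r ^ 2) := by positivity
  have h2 : 0 ≤ m * ((d' - 1) ^ 2 + r' ^ 2) := by positivity
  have h3 : l * ((d - 1) ^ 2 + r ^ 2) + m * ((d' - 1) ^ 2 + r' ^ 2)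
      = l * (r ^ 2 + d ^ 2) + m * (r' ^ 2 + d' ^ 2) - 2 * (l * d + m * d') + (l + m) := by ring
  constructor <;> linarith

omit [InnerProductSpace ℂ L] [CompleteSpace L] in
theorem eq_one_and_eq_zero {d : ℝ} {w : L} (h : (d - 1) ^ 2 + ‖w‖ ^ 2 = 0) : d = 1 ∧ w = 0 := by
  obtain ⟨h1, h2⟩ := (add_eq_zero_iff_of_nonneg (sq_nonneg _) (sq_nonneg _)).mp h
  exact ⟨sub_eq_zero.mp (pow_eq_zero_iff two_ne_zero |>.mp h1),
    norm_eq_zero.mp (pow_eq_zero_iff two_ne_zero |>.mp h2)⟩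

set_option maxHeartbeats 1000000 in
/-- If a pure map has a nontrivial dilation by one dimension, then it has a pure one. -/
theorem exists_pure_oneStepDilation (hψ : IsPure ψ)
    (hidem : ∀ x, ψ hS.one (ψ hS.one x) = ψ hS.one x) (he : ‖e‖ = 1) (hpe : ψ hS.one e = 0)
    {χ₀ : S →ₗ[ℂ] (L →L[ℂ] L)} (hχ₀ : χ₀ ∈ oneStepDilations hS ψ e) {s₀ : S} {x₀ : L}
    (hx₀ : ψ hS.one x₀ = x₀) (hpos : 0 < (⟪e, χ₀ s₀ x₀⟫_ℂ).re) :
    ∃ χ ∈ oneStepDilations hS ψ e, IsPure χ := by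
  set D := oneStepDilations hS ψ e with hD
  have hcomp : IsCompact (coefficients '' D) := isCompact_oneStepDilations hψ.1 hidem he hpe
  let ℓ : (S × L × L → ℂ) → ℝ := fun k => (k (s₀, e, x₀)).re
  have hℓ : Continuous ℓ := Complex.continuous_re.comp (continuous_apply _)
  obtain ⟨_, ⟨χm, hχm, rfl⟩, hmax⟩ :=
    hcomp.exists_isMaxOn ⟨_, Set.mem_image_of_mem _ hχ₀⟩ hℓ.continuousOn
  set η : ℝ := (⟪e, χm s₀ x₀⟫_ℂ).re with hη
  have hle : ∀ χ ∈ D, (⟪e, χ s₀ x₀⟫_ℂ).re ≤ η := fun χ hχ => hmax (Set.mem_image_of_mem _ hχ)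
  have hη0 : 0 < η := hpos.trans_le (hle χ₀ hχ₀)
  have hFcomp : IsCompact (coefficients '' D ∩ ℓ ⁻¹' {η}) :=
    hcomp.inter_right (isClosed_singleton.preimage hℓ)
  obtain ⟨_, hext⟩ := hFcomp.extremePoints_nonempty ⟨_, Set.mem_image_of_mem _ hχm, rfl⟩
  obtain ⟨⟨⟨χ, hχ, rfl⟩, hχη⟩, hext⟩ := hext
  replace hχη : (⟪e, χ s₀ x₀⟫_ℂ).re = η := hχη
  refine ⟨χ, hχ, hχ.1, fun τ hτ hσ => ?_⟩
  set σ := χ - τ with hσdef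
  have hx₀0 : 0 < (⟪x₀, ψ hS.one x₀⟫_ℂ).re := by
    rw [hx₀, inner_self_eq_norm_sq_to_K]
    have : x₀ ≠ 0 := fun h => by simp [h] at hpos
    have : 0 < ‖x₀‖ ^ 2 := by positivity
    simpa [← Complex.ofReal_pow] using this
  obtain ⟨l, hl0, hl⟩ := exists_smul_of_pure hψ hχ.2.2 hτ hσ hS hx₀0
  obtain ⟨m, hm0, hm⟩ := exists_smul_of_pure hψ hχ.2.2 hσ (by simpa [hσdef] using hτ) hS hx₀0
  have hlm : l + m = 1 := by
    have h1 : ((l : ℂ) + m) • ψ = ψ := by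
      rw [add_smul, ← hl, ← hm, ← compress_add, hσdef, add_sub_cancel, hχ.2.2]
    have h2 := congrArg (fun θ : S →ₗ[ℂ] (L →L[ℂ] L) => (⟪x₀, θ hS.one x₀⟫_ℂ).re) h1
    simp only [LinearMap.smul_apply, smul_apply, inner_smul_right, ← Complex.ofReal_add,
      Complex.re_ofReal_mul] at h2
    exact mul_right_cancel₀ hx₀0.ne' (by rw [h2, one_mul])
  have hadd : ∀ s x, τ s x + σ s x = χ s x := fun s x => by simp [hσdef]
  have hsum : ∀ x y, ⟪x, τ hS.one y⟫_ℂ + ⟪x, σ hS.one y⟫_ℂ = ⟪x, χ hS.one y⟫_ℂ := fun x y => by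
    rw [← inner_add_right, hadd]
  have hnull : ∀ x, ψ hS.one x = 0 → ⟪e, x⟫_ℂ = 0 →
      (⟪x, τ hS.one x⟫_ℂ).re + (⟪x, σ hS.one x⟫_ℂ).re = 0 := fun x h1 h2 => by
    rw [← Complex.add_re, hsum, hχ.2.1, h1, h2]; simp
  have hsτ : ∀ x, ψ hS.one x = 0 → ⟪e, x⟫_ℂ = 0 → τ hS.one x = 0 := fun x h1 h2 =>
    hτ.apply_eq_zero_of_null hS (by linarith [hnull x h1 h2, hσ.re_one_nonneg hS x]) _
  have hsσ : ∀ x, ψ hS.one x = 0 → ⟪e, x⟫_ℂ = 0 → σ hS.one x = 0 := fun x h1 h2 =>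
    hσ.apply_eq_zero_of_null hS (by linarith [hnull x h1 h2, hτ.re_one_nonneg hS x]) _
  obtain ⟨w, d, hα, hest, hmem⟩ := oneStep_estimate hτ he hpe hψ.1 hidem hsτ hl0 hl hx₀ hle
  obtain ⟨w', d', hα', hest', hmem'⟩ := oneStep_estimate hσ he hpe hψ.1 hidem hsσ hm0 hm hx₀ hle
  have hχe : χ hS.one e = e := by
    rw [hχ.2.1, hpe, inner_self_eq_norm_sq_to_K, he]; simp
  have hαα : (⟪e, τ hS.one e⟫_ℂ).re + (⟪e, σ hS.one e⟫_ℂ).re = 1 := by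
    rw [← Complex.add_re, hsum, hχe, inner_self_eq_norm_sq_to_K, he]; simp
  have hvv : (⟪ψ hS.one (τ hS.one e), ψ s₀ x₀⟫_ℂ).re
      + (⟪ψ hS.one (σ hS.one e), ψ s₀ x₀⟫_ℂ).re = 0 := by
    rw [← Complex.add_re, ← inner_add_left, ← map_add, hadd, hχe, hpe]; simp
  have hηη : (⟪e, τ s₀ x₀⟫_ℂ).re + (⟪e, σ s₀ x₀⟫_ℂ).re = η := by
    rw [← Complex.add_re, ← inner_add_right, hadd, hχη]
  -- The contributions of `w` and `w'` cancel because `ψ(1)χ(1)e = ψ(1)e = 0`; what remains is `η ≤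
  -- (ld + md')η`.
  have hd : 1 ≤ l * d + m * d' := by
    have : η ≤ (l * d + m * d') * η := by linarith
    exact le_of_mul_le_mul_right (by linarith) hη0
  obtain ⟨h1, h2⟩ := weights_rigid hl0 hm0 hlm hαα hα hα' hd
  -- If one weight vanishes, the other summand already has mass at least `1` at `e`, leaving none
  -- for this one.
  rcases hl0.eq_or_lt with rfl | hlpos
  · have hm1 : m = 1 := by linarith
    obtain ⟨rfl, rfl⟩ := eq_one_and_eq_zero
      ((mul_eq_zero.mp h2).resolve_left (by rw [hm1]; exact one_ne_zero))
    refine ⟨0, ?_⟩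
    rw [zero_smul]
    refine eq_zero_of_support hτ he hpe hψ.1 hidem hsτ (by simpa using hl) ?_
    rw [hm1] at hα'
    simp at hα'
    linarith
  · obtain ⟨rfl, rfl⟩ := eq_one_and_eq_zero ((mul_eq_zero.mp h1).resolve_left hlpos.ne')
    rcases hm0.eq_or_lt with rfl | hmpos
    · have hl1 : l = 1 := by linarith
      refine ⟨1, ?_⟩
      have : σ = 0 := by
        refine eq_zero_of_support hσ he hpe hψ.1 hidem hsσ (by simpa using hm) ?_
        rw [hl1] at hα
        simp at hα
        linarith
      rw [one_smul]
      exact (sub_eq_zero.mp this).symm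
    · obtain ⟨rfl, rfl⟩ := eq_one_and_eq_zero ((mul_eq_zero.mp h2).resolve_left hmpos.ne')
      have m1 := hmem rfl rfl hlpos
      have m2 := hmem' rfl rfl hmpos
      have e1 := hle _ m1
      have e2 := hle _ m2
      rw [LinearMap.smul_apply, smul_apply, inner_smul_right, Complex.re_ofReal_mul] at e1 e2
      rw [inv_mul_le_iff₀ hlpos] at e1
      rw [inv_mul_le_iff₀ hmpos] at e2
      have hlη : (⟪e, τ s₀ x₀⟫_ℂ).re = l * η := by
        have : l * η + m * η = η := by rw [← add_mul, hlm, one_mul]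
        linarith
      have hmη : (⟪e, σ s₀ x₀⟫_ℂ).re = m * η := by
        have : l * η + m * η = η := by rw [← add_mul, hlm, one_mul]
        linarith
      have f1 : coefficients (((l⁻¹ : ℝ) : ℂ) • τ) ∈ coefficients '' D ∩ ℓ ⁻¹' {η} := by
        refine ⟨Set.mem_image_of_mem _ m1, ?_⟩
        change (⟪e, (((l⁻¹ : ℝ) : ℂ) • τ) s₀ x₀⟫_ℂ).re = η
        rw [LinearMap.smul_apply, smul_apply, inner_smul_right, Complex.re_ofReal_mul, hlη]
        field_simp
      have f2 : coefficients (((m⁻¹ : ℝ) : ℂ) • σ) ∈ coefficients '' D ∩ ℓ ⁻¹' {η} := by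
        refine ⟨Set.mem_image_of_mem _ m2, ?_⟩
        change (⟪e, (((m⁻¹ : ℝ) : ℂ) • σ) s₀ x₀⟫_ℂ).re = η
        rw [LinearMap.smul_apply, smul_apply, inner_smul_right, Complex.re_ofReal_mul, hmη]
        field_simp
      have hlC : (l : ℂ) ≠ 0 := by exact_mod_cast hlpos.ne'
      have hmC : (m : ℂ) ≠ 0 := by exact_mod_cast hmpos.ne'
      have hseg : coefficients χ ∈ openSegment ℝ (coefficients (((l⁻¹ : ℝ) : ℂ) • τ))
          (coefficients (((m⁻¹ : ℝ) : ℂ) • σ)) := by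
        refine ⟨l, m, hlpos, hmpos, hlm, funext fun p => ?_⟩
        simp only [coefficients, Pi.add_apply, Pi.smul_apply, LinearMap.smul_apply, smul_apply,
          inner_smul_right, Complex.real_smul, ← hadd, inner_add_right]
        push_cast
        field_simp
      have := coefficients_injective (hext f1 f2 hseg)
      refine ⟨(l : ℂ), ?_⟩
      rw [← this, smul_smul]
      simp [hlC]

end PureStep

/-! ### The dilation order and Zorn's lemma. -/

section PureOrder

open Filter Topology

variable {A : Type u} [CStarAlgebra A] [PartialOrder A] [StarOrderedRing A]
  {S : Submodule ℂ A} {L : Type*} [NormedAddCommGroup L] [InnerProductSpace ℂ L]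
  [CompleteSpace L]

theorem IsCP.compress_eq_of_support (hS : IsOperatorSystem S) {τ : S →ₗ[ℂ] (L →L[ℂ] L)}
    (hτ : IsCP τ) {p : L →L[ℂ] L} (hidem : ∀ x, p (p x) = p x)
    (h : ∀ x, p x = 0 → (⟪x, τ hS.one x⟫_ℂ).re ≤ 0) : _root_.compress p τ = τ := by
  have h1 : ∀ s y, τ s (p y) = τ s y := fun s y => by
    rw [← sub_eq_zero, ← map_sub]
    exact hτ.apply_eq_zero_of_null hS (h _ (by rw [map_sub, hidem, sub_self])) s
  refine ext_inner_form fun s x y => (starRingEnd ℂ).injective ?_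
  rw [inner_compress, h1, ← hτ.inner_star hS, ← hτ.inner_star hS, h1]

theorem IsCP.compress_one_self (hS : IsOperatorSystem S) {τ : S →ₗ[ℂ] (L →L[ℂ] L)}
    (hτ : IsCP τ) (hidem : ∀ x, τ hS.one (τ hS.one x) = τ hS.one x) :
    _root_.compress (τ hS.one) τ = τ :=
  hτ.compress_eq_of_support hS hidem fun x hx => by rw [hx]; simp

theorem IsCP.re_one_le_of_idem (hS : IsOperatorSystem S) {τ : S →ₗ[ℂ] (L →L[ℂ] L)}
    (hτ : IsCP τ) (hidem : ∀ x, τ hS.one (τ hS.one x) = τ hS.one x) (x : L) :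
    (⟪x, τ hS.one x⟫_ℂ).re ≤ ‖x‖ ^ 2 := by
  have h : (⟪x, τ hS.one x⟫_ℂ).re = ‖τ hS.one x‖ ^ 2 := by
    rw [← hidem, ← hτ.one_symm hS, inner_self_eq_norm_sq_to_K, hidem]
    simp [← Complex.ofReal_pow]
  have h2 : (⟪x, τ hS.one x⟫_ℂ).re ≤ ‖x‖ * ‖τ hS.one x‖ :=
    (Complex.re_le_norm _).trans (norm_inner_le_norm _ _)
  nlinarith [sq_nonneg (‖x‖ - ‖τ hS.one x‖)]

variable {hS : IsOperatorSystem S} {ψ ψ' ψ'' : S →ₗ[ℂ] (L →L[ℂ] L)}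

/-- For `y` in the range of `ψ(1)`, the projection `ψ'(1)` satisfies `‖ψ'(1)y - y‖² = ‖y‖² - ⟪y,
ψ'(1)y⟫ = 0`. Thus the subspaces grow along the order. -/
theorem one_apply_one_of_compress (hψ : IsCP ψ) (hψ' : IsCP ψ')
    (hidem : ∀ x, ψ hS.one (ψ hS.one x) = ψ hS.one x)
    (hidem' : ∀ x, ψ' hS.one (ψ' hS.one x) = ψ' hS.one x)
    (h : compress (ψ hS.one) ψ' = ψ) (x : L) : ψ' hS.one (ψ hS.one x) = ψ hS.one x := by
  set y := ψ hS.one x with hy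
  have h1 : ⟪y, ψ' hS.one y⟫_ℂ = ⟪y, y⟫_ℂ := by
    have := inner_compress (ψ hS.one) ψ' hS.one x x
    rw [h, ← hy] at this
    rw [← this, hy, hψ.one_symm hS, hidem]
  rw [← sub_eq_zero, ← inner_self_eq_zero (𝕜 := ℂ)]
  rw [inner_sub_left, inner_sub_right, inner_sub_right, hψ'.one_symm hS, hidem',
    hψ'.one_symm hS, h1]
  ring

theorem compress_trans (hψ : IsCP ψ) (hψ' : IsCP ψ')
    (hidem : ∀ x, ψ hS.one (ψ hS.one x) = ψ hS.one x)
    (hidem' : ∀ x, ψ' hS.one (ψ' hS.one x) = ψ' hS.one x)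
    (h : compress (ψ hS.one) ψ' = ψ) (h' : compress (ψ' hS.one) ψ'' = ψ') :
    compress (ψ hS.one) ψ'' = ψ := by
  have h1 : ψ' hS.one ∘L ψ hS.one = ψ hS.one :=
    ContinuousLinearMap.ext (one_apply_one_of_compress hψ hψ' hidem hidem' h)
  rw [← h1, ← compress_compress, h', h]

theorem compress_antisymm (hψ : IsCP ψ) (hψ' : IsCP ψ')
    (hidem : ∀ x, ψ hS.one (ψ hS.one x) = ψ hS.one x)
    (hidem' : ∀ x, ψ' hS.one (ψ' hS.one x) = ψ' hS.one x)
    (h : compress (ψ hS.one) ψ' = ψ) (h' : compress (ψ' hS.one) ψ = ψ') : ψ' = ψ := by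
  have h1 : ψ hS.one = ψ' hS.one := by
    refine ContinuousLinearMap.ext fun x => ext_inner_left ℂ fun y => ?_
    rw [← one_apply_one_of_compress hψ hψ' hidem hidem' h x, ← hψ'.one_symm hS,
      ← one_apply_one_of_compress hψ' hψ hidem' hidem h' y, hψ.one_symm hS, hidem,
      ← hψ.one_symm hS, one_apply_one_of_compress hψ' hψ hidem' hidem h' y, hψ'.one_symm hS]
  rw [← h, h1, hψ'.compress_one_self hS hidem']

/-- A pure limit of an increasing net of pure maps whose values at the unit are projections. -/
theorem exists_pure_upper_bound {ι : Type*} [Nonempty ι] (ψ : ι → S →ₗ[ℂ] (L →L[ℂ] L))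
    (hpure : ∀ i, IsPure (ψ i)) (hidem : ∀ i x, ψ i hS.one (ψ i hS.one x) = ψ i hS.one x)
    (hdir : ∀ i j, ∃ k, compress (ψ i hS.one) (ψ k) = ψ i ∧ compress (ψ j hS.one) (ψ k) = ψ j)
    {φ : S →ₗ[ℂ] (L →L[ℂ] L)} (hφ : IsCP φ) (hφ0 : φ ≠ 0)
    (hφidem : ∀ x, φ hS.one (φ hS.one x) = φ hS.one x)
    (hφψ : ∀ i, compress (φ hS.one) (ψ i) = φ) :
    ∃ χ : S →ₗ[ℂ] (L →L[ℂ] L), IsPure χ ∧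
      (∀ x, χ hS.one (χ hS.one x) = χ hS.one x) ∧ ∀ i, compress (ψ i hS.one) χ = ψ i := by
  have htrans : ∀ i j k, compress (ψ i hS.one) (ψ j) = ψ i →
      compress (ψ j hS.one) (ψ k) = ψ j → compress (ψ i hS.one) (ψ k) = ψ i := fun i j k h h' =>
    compress_trans (hpure i).1 (hpure j).1 (hidem i) (hidem j) h h'
  let T : ι → Set ι := fun i => {j | compress (ψ i hS.one) (ψ j) = ψ i}
  have hne : NeBot (⨅ i, 𝓟 (T i)) := by
    refine iInf_neBot_of_directed' ?_ fun i => principal_neBot_iff.mpr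
      ⟨i, (hpure i).1.compress_one_self hS (hidem i)⟩
    intro i j
    obtain ⟨k, hik, hjk⟩ := hdir i j
    exact ⟨k, principal_mono.mpr fun l hl => htrans _ _ _ hik hl,
      principal_mono.mpr fun l hl => htrans _ _ _ hjk hl⟩
  let U : Ultrafilter ι := Ultrafilter.of (⨅ i, 𝓟 (T i))
  have hT : ∀ i, ∀ᶠ j in (U : Filter ι), compress (ψ i hS.one) (ψ j) = ψ i := fun i =>
    Ultrafilter.of_le _ (mem_iInf_of_mem i (mem_principal_self _))
  obtain ⟨χ, hχ, hlim⟩ := exists_ultralimit hS U ψ (fun i => (hpure i).1)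
    fun i => (hpure i).1.re_one_le_of_idem hS (hidem i)
  have hcompr : ∀ i, compress (ψ i hS.one) χ = ψ i := by
    refine fun i => ext_inner_form fun s x y => ?_
    rw [inner_compress]
    refine tendsto_nhds_unique (hlim _ _ _) (tendsto_const_nhds.congr' ?_)
    filter_upwards [hT i] with j hj
    rw [← inner_compress, hj]
  have hχψ : ∀ i x, χ hS.one (ψ i hS.one x) = ψ i hS.one x := by
    refine fun i x => ext_inner_left ℂ fun y => ?_
    refine tendsto_nhds_unique (hlim _ _ _) (tendsto_const_nhds.congr' ?_)
    filter_upwards [hT i] with j hj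
    rw [one_apply_one_of_compress (hpure i).1 (hpure j).1 (hidem i) (hidem j) hj]
  -- A weak limit of projections need not be a projection; here it is one because `χ(1)` fixes the
  -- range of every `ψᵢ(1)`.
  have hχidem : ∀ x, χ hS.one (χ hS.one x) = χ hS.one x := by
    refine fun x => ext_inner_left ℂ fun y => ?_
    rw [← hχ.one_symm hS]
    refine tendsto_nhds_unique (hlim hS.one (χ hS.one y) x) ((hlim hS.one y x).congr fun i => ?_)
    rw [hχ.one_symm hS, hχψ]
  refine ⟨χ, ⟨hχ, fun τ hτ hσ => ?_⟩, hχidem, hcompr⟩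
  have h1 : ∀ i, ∃ t : ℂ, compress (ψ i hS.one) τ = t • ψ i := fun i =>
    (hpure i).2 _ (hτ.compress _) (by
      have := hσ.compress (ψ i hS.one)
      rwa [compress_sub, hcompr i] at this)
  choose t ht using h1
  have h2 : ∀ i, compress (φ hS.one) τ = t i • φ := by
    intro i
    have h3 : ψ i hS.one ∘L φ hS.one = φ hS.one := ContinuousLinearMap.ext
      (one_apply_one_of_compress hφ (hpure i).1 hφidem (hidem i) (hφψ i))
    rw [← h3, ← compress_compress, ht, compress_smul, hφψ]
  obtain ⟨i₀⟩ := ‹Nonempty ι›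
  -- All the scalars agree because each is visible on the common nonzero compression `φ`.
  have hteq : ∀ i, t i = t i₀ := fun i => by
    have := (h2 i).symm.trans (h2 i₀)
    obtain ⟨s, hs⟩ := DFunLike.ne_iff.mp hφ0
    obtain ⟨x, hx⟩ := DFunLike.ne_iff.mp hs
    exact smul_left_injective ℂ hx (congrArg (fun θ => θ s x) this)
  refine ⟨t i₀, ?_⟩
  have hD : ∀ i, compress (ψ i hS.one) (τ - t i₀ • χ) = 0 := fun i => by
    rw [compress_sub, compress_smul, hcompr, ht, hteq, sub_self]
  have hD2 : ∀ i j s x y, ⟪ψ i hS.one x, (τ - t i₀ • χ) s (ψ j hS.one y)⟫_ℂ = 0 := by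
    intro i j s x y
    obtain ⟨k, hik, hjk⟩ := hdir i j
    rw [← one_apply_one_of_compress (hpure i).1 (hpure k).1 (hidem i) (hidem k) hik,
      ← one_apply_one_of_compress (hpure j).1 (hpure k).1 (hidem j) (hidem k) hjk,
      ← inner_compress, hD]
    simp
  -- The convergence `ψᵢ(1) → χ(1)` is only weak, so the limit is taken in one variable at a time.
  have hD3 : ∀ j s x y, ⟪χ hS.one x, (τ - t i₀ • χ) s (ψ j hS.one y)⟫_ℂ = 0 := by
    intro j s x y
    rw [hχ.one_symm hS]
    refine tendsto_nhds_unique (hlim hS.one x _) (tendsto_const_nhds.congr fun i => ?_)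
    rw [← (hpure i).1.one_symm hS, hD2]
  have hD4 : compress (χ hS.one) (τ - t i₀ • χ) = 0 := by
    refine ext_inner_form fun s x y => ?_
    rw [inner_compress, ← ContinuousLinearMap.adjoint_inner_left]
    refine tendsto_nhds_unique (hlim hS.one _ y) (tendsto_const_nhds.congr fun i => ?_)
    rw [ContinuousLinearMap.adjoint_inner_left, hD3]
    simp
  have hτχ : compress (χ hS.one) τ = τ := hτ.compress_eq_of_support hS hχidem fun x hx => by
    have h3 := hσ.re_one_nonneg hS x
    rw [LinearMap.sub_apply, sub_apply, inner_sub_right, hx] at h3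
    simpa using h3
  rw [compress_sub, compress_smul, hτχ, hχ.compress_one_self hS hχidem] at hD4
  exact sub_eq_zero.mp hD4

theorem exists_maximal_pure {φ : S →ₗ[ℂ] (L →L[ℂ] L)} (hφ : IsPure φ) (hφ0 : φ ≠ 0)
    (hφidem : ∀ x, φ hS.one (φ hS.one x) = φ hS.one x) :
    ∃ ψ : S →ₗ[ℂ] (L →L[ℂ] L), IsPure ψ ∧
      (∀ x, ψ hS.one (ψ hS.one x) = ψ hS.one x) ∧ compress (φ hS.one) ψ = φ ∧
      ∀ ψ' : S →ₗ[ℂ] (L →L[ℂ] L), IsPure ψ' →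
        (∀ x, ψ' hS.one (ψ' hS.one x) = ψ' hS.one x) → compress (ψ hS.one) ψ' = ψ → ψ' = ψ := by
  let P := {ψ : S →ₗ[ℂ] (L →L[ℂ] L) // IsPure ψ ∧
      (∀ x, ψ hS.one (ψ hS.one x) = ψ hS.one x) ∧ compress (φ hS.one) ψ = φ}
  let r : P → P → Prop := fun ψ ψ' => compress (ψ.1 hS.one) ψ'.1 = ψ.1
  have hrefl : ∀ ψ : P, r ψ ψ := fun ψ => ψ.2.1.1.compress_one_self hS ψ.2.2.1
  have htrans : ∀ {a b c : P}, r a b → r b c → r a c := fun {a b c} h h' =>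
    compress_trans a.2.1.1 b.2.1.1 a.2.2.1 b.2.2.1 h h'
  obtain ⟨m, hm⟩ := exists_maximal_of_chains_bounded (r := r) (fun C hC => by
    rcases C.eq_empty_or_nonempty with rfl | hne
    · exact ⟨⟨φ, hφ, hφidem, hφ.1.compress_one_self hS hφidem⟩, by simp⟩
    · have : Nonempty C := hne.to_subtype
      obtain ⟨χ, h1, h2, h3⟩ := exists_pure_upper_bound (fun i : C => i.1.1)
        (fun i => i.1.2.1) (fun i => i.1.2.2.1) (fun i j => by
          rcases eq_or_ne i j with rfl | hij
          · exact ⟨i, hrefl i, hrefl i⟩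
          rcases hC i.2 j.2 (Subtype.coe_injective.ne hij) with h | h
          · exact ⟨j, h, hrefl j⟩
          · exact ⟨i, hrefl i, h⟩) hφ.1 hφ0 hφidem (fun i => i.1.2.2.2)
      obtain ⟨i, hi⟩ := hne
      exact ⟨⟨χ, h1, h2, compress_trans hφ.1 i.2.1.1 hφidem i.2.2.1 i.2.2.2 (h3 ⟨i, hi⟩)⟩,
        fun a ha => h3 ⟨a, ha⟩⟩) htrans
  refine ⟨m.1, m.2.1, m.2.2.1, m.2.2.2, fun ψ' h1 h2 h3 => ?_⟩
  have h4 := compress_trans hφ.1 m.2.1.1 hφidem m.2.2.1 m.2.2.2 h3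
  exact compress_antisymm m.2.1.1 h1.1 m.2.2.1 h2 h3 (hm ⟨ψ', h1, h2, h4⟩ h3)

end PureOrder

/-! ### Purity under extension by zero and restriction to the support. -/

section PureTransfer

variable {A : Type u} [CStarAlgebra A] [PartialOrder A] [StarOrderedRing A]
  {S : Submodule ℂ A} {H L : Type*} [NormedAddCommGroup L] [InnerProductSpace ℂ L]
  [CompleteSpace L] [NormedAddCommGroup H] [InnerProductSpace ℂ H] [CompleteSpace H]

theorem IsPure.compress_adjoint (hS : IsOperatorSystem S) {φ : S →ₗ[ℂ] (H →L[ℂ] H)}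
    (hφ : IsPure φ) {J : H →L[ℂ] L} (hJ : ∀ x, ContinuousLinearMap.adjoint J (J x) = x) :
    IsPure (compress (ContinuousLinearMap.adjoint J) φ) := by
  refine ⟨hφ.1.compress _, fun τ hτ hσ => ?_⟩
  have hJJ : ContinuousLinearMap.adjoint J ∘L J = ContinuousLinearMap.id ℂ H :=
    ContinuousLinearMap.ext hJ
  obtain ⟨t, ht⟩ := hφ.2 (compress J τ) (hτ.compress J) (by
    have := hσ.compress J
    rwa [compress_sub, compress_compress, hJJ, compress_id] at this)
  refine ⟨t, ?_⟩
  rw [← compress_smul, ← ht, compress_compress]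
  refine (hτ.compress_eq_of_support hS (fun x => by simp [hJ]) fun x hx => ?_).symm
  have hx' : ContinuousLinearMap.adjoint J x = 0 := by
    have := congrArg (ContinuousLinearMap.adjoint J) hx
    simpa [hJ] using this
  have h := hσ.re_one_nonneg hS x
  rw [LinearMap.sub_apply, sub_apply, inner_sub_right, inner_compress, hx'] at h
  simpa using h

theorem IsPure.compress_of_compress_self {ψ : S →ₗ[ℂ] (L →L[ℂ] L)} (hψ : IsPure ψ)
    {J : H →L[ℂ] L} (hJ : ∀ x, ContinuousLinearMap.adjoint J (J x) = x)
    (hψJ : compress (J ∘L ContinuousLinearMap.adjoint J) ψ = ψ) : IsPure (compress J ψ) := by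
  refine ⟨hψ.1.compress _, fun τ hτ hσ => ?_⟩
  have hJJ : ContinuousLinearMap.adjoint J ∘L J = ContinuousLinearMap.id ℂ H :=
    ContinuousLinearMap.ext hJ
  obtain ⟨t, ht⟩ := hψ.2 (compress (ContinuousLinearMap.adjoint J) τ) (hτ.compress _) (by
    have := hσ.compress (ContinuousLinearMap.adjoint J)
    rwa [compress_sub, compress_compress, hψJ] at this)
  refine ⟨t, ?_⟩
  rw [← compress_smul, ← ht, compress_compress, hJJ, compress_id]

end PureTransfer

/-! ### Irreducibility of pure maps and the resulting size bound. -/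

section Irreducible

variable {A : Type u} [CStarAlgebra A] [PartialOrder A] [StarOrderedRing A]
  {S : Submodule ℂ A} {L : Type*} [NormedAddCommGroup L] [InnerProductSpace ℂ L]
  [CompleteSpace L]

/-- A closed subspace that is invariant under the range of a pure unital map is trivial. -/
theorem IsPure.eq_bot_or_eq_top (hS : IsOperatorSystem S) {ψ : S →ₗ[ℂ] (L →L[ℂ] L)}
    (hψ : IsPure ψ) (hone : ψ hS.one = 1) (M : Submodule ℂ L) (hM : IsClosed (M : Set L))
    (hinv : ∀ s, ∀ x ∈ M, ψ s x ∈ M) : M = ⊥ ∨ M = ⊤ := by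
  have : CompleteSpace M := hM.completeSpace_coe
  set P := M.starProjection with hP
  have hPmem : ∀ x, P x ∈ M := fun x => M.starProjection_apply_mem x
  have hPsymm : ∀ x y, ⟪P x, y⟫_ℂ = ⟪x, P y⟫_ℂ := M.inner_starProjection_left_eq_right
  have hPfix : ∀ x ∈ M, P x = x := fun x hx => M.starProjection_eq_self_iff.mpr hx
  have hPψ : ∀ s x y, ⟪x, ψ s (P y)⟫_ℂ = ⟪P x, ψ s (P y)⟫_ℂ := fun s x y => by
    rw [hPsymm, hPfix _ (hinv s _ (hPmem y))]
  have hψP : ∀ s x y, ⟪P x, ψ s y⟫_ℂ = ⟪P x, ψ s (P y)⟫_ℂ := fun s x y => by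
    refine (starRingEnd ℂ).injective ?_
    rw [← hψ.1.inner_star hS, ← hψ.1.inner_star hS, hPψ]
  -- `P` commutes with the range of `ψ`, so the difference is the compression by `1 - P`, hence
  -- c.p.; purity then makes `P` a scalar.
  have hcomp : ψ - compress P ψ = compress (ContinuousLinearMap.id ℂ L - P) ψ := by
    refine ext_inner_form fun s x y => ?_
    rw [inner_compress, LinearMap.sub_apply, sub_apply, inner_sub_right, inner_compress]
    simp only [sub_apply, ContinuousLinearMap.id_apply, inner_sub_left, inner_sub_right, map_sub,
      hψP s x y, hPψ s x y]
    ring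
  obtain ⟨t, ht⟩ := hψ.2 (compress P ψ) (hψ.1.compress P) (hcomp ▸ hψ.1.compress _)
  have hPt : ∀ x, P x = t • x := fun x => ext_inner_left ℂ fun y => by
    have h := inner_compress P ψ hS.one y x
    rw [ht, LinearMap.smul_apply, hone] at h
    simp only [smul_apply, one_apply_eq_self] at h
    rw [h, hPsymm, hPfix _ (hPmem x)]
  by_cases ht0 : t = 0
  · left
    refine (Submodule.eq_bot_iff _).mpr fun x hx => ?_
    rw [← hPfix x hx, hPt, ht0, zero_smul]
  · right
    refine (Submodule.eq_top_iff').mpr fun x => ?_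
    have := M.smul_mem t⁻¹ (hPt x ▸ hPmem x)
    rwa [smul_smul, inv_mul_cancel₀ ht0, one_smul] at this

open TensorProduct in
/-- A pure unital map on `L` is cyclic for every nonzero vector, so that `L` cannot be too large. -/
theorem IsPure.denseRange (hS : IsOperatorSystem S) {ψ : S →ₗ[ℂ] (L →L[ℂ] L)}
    (hψ : IsPure ψ) (hone : ψ hS.one = 1) {H : Type*} [AddCommGroup H] [Module ℂ H]
    (J : H →ₗ[ℂ] L) {h : H} (hJ : J h ≠ 0) :
    ∃ Θ : FreeAlgebra ℂ S ⊗[ℂ] H → L, DenseRange Θ := by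
  -- Words in the operators `ψ(s)`: the free algebra gives an index set that depends on `S` but not
  -- on `L`.
  let ρ : FreeAlgebra ℂ S →ₐ[ℂ] Module.End ℂ L :=
    FreeAlgebra.lift ℂ fun s => (ψ s : L →ₗ[ℂ] L)
  let Θ : FreeAlgebra ℂ S ⊗[ℂ] H →ₗ[ℂ] L :=
    TensorProduct.lift ((LinearMap.lcomp ℂ L J) ∘ₗ ρ.toLinearMap)
  have hΘ : ∀ a h, Θ (a ⊗ₜ h) = ρ a (J h) := fun a h => rfl
  refine ⟨Θ, ?_⟩
  have hinv : ∀ s t, ψ s (Θ t) ∈ LinearMap.range Θ := by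
    intro s t
    induction t using TensorProduct.induction_on with
    | zero => simp
    | tmul a h =>
      refine ⟨(FreeAlgebra.ι ℂ s * a) ⊗ₜ h, ?_⟩
      rw [hΘ, hΘ, map_mul, Module.End.mul_apply, FreeAlgebra.lift_ι_apply]
      rfl
    | add a b ha hb => rw [map_add, map_add]; exact add_mem ha hb
  rcases hψ.eq_bot_or_eq_top hS hone (LinearMap.range Θ).topologicalClosure
    (Submodule.isClosed_topologicalClosure _) (fun s x hx => by
      refine map_mem_closure (ψ s).continuous hx ?_
      rintro _ ⟨t, rfl⟩
      exact hinv s t) with hbot | htop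
  · refine absurd ?_ hJ
    have h1 : Θ (1 ⊗ₜ h) = J h := by rw [hΘ, map_one]; rfl
    have h2 : J h ∈ (LinearMap.range Θ).topologicalClosure :=
      Submodule.le_topologicalClosure _ ⟨_, h1⟩
    rwa [hbot] at h2
  · have := (Submodule.dense_iff_topologicalClosure_eq_top).mpr htop
    exact this

-- Orthonormal vectors are `√2` apart, so choosing a value of `Θ` within `1/2` of each would inject
-- `Set T` into `T`, against Cantor.
omit [CompleteSpace L] in
theorem not_denseRange_of_orthonormal {T : Type*} {e : Set T → L} (he : Orthonormal ℂ e)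
    (Θ : T → L) : ¬ DenseRange Θ := by
  intro hΘ
  have h1 : ∀ i, ∃ t, dist (e i) (Θ t) < 1 / 2 := fun i => hΘ.exists_dist_lt (e i) (by norm_num)
  choose f hf using h1
  refine Function.cantor_injective f fun i j hij => ?_
  by_contra hne
  have h2 : dist (e i) (e j) < 1 := by
    have := dist_triangle_right (e i) (e j) (Θ (f i))
    have h3 := hf i
    have h4 := hf j
    rw [← hij] at h4
    linarith
  have h5 := norm_sub_sq (𝕜 := ℂ) (e i) (e j)
  rw [he.1, he.1, he.2 hne, ← dist_eq_norm, map_zero] at h5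
  nlinarith [dist_nonneg (x := e i) (y := e j)]

end Irreducible

/-! ### From pure maximal maps to boundary representations. -/

section Subrep

variable {A : Type u} [CStarAlgebra A] [PartialOrder A] [StarOrderedRing A]
  {S : Submodule ℂ A} {L : Type*} [NormedAddCommGroup L] [InnerProductSpace ℂ L]
  [CompleteSpace L] {M : Type*} [NormedAddCommGroup M] [InnerProductSpace ℂ M]
  [CompleteSpace M]

/-- The restriction of a ⋆-representation of `A` to a map on `S` is completely positive. -/
theorem isCP_restrict (ρ : A →⋆ₐ[ℂ] (L →L[ℂ] L)) :
    IsCP ((ρ.toAlgHom.toLinearMap ∘ₗ S.subtype : S →ₗ[ℂ] (L →L[ℂ] L))) := by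
  intro n X hX
  obtain ⟨Y, hY⟩ := CStarAlgebra.exists_eq_star_mul_self_of_nonneg hX
  suffices X.map (fun s : S => (ρ (s : A) : L →L[ℂ] L)) = star (Y.map ρ) * Y.map ρ from
    this ▸ star_mul_self_nonneg (Y.map ρ)
  refine CStarMatrix.ext fun i j => ?_
  have h := congrArg ρ (congrFun (congrFun hY i) j)
  simp only [CStarMatrix.mul_apply, CStarMatrix.star_apply, map_sum, map_mul, map_star] at h
  simpa only [CStarMatrix.mul_apply, CStarMatrix.star_apply, CStarMatrix.map_apply] using h

omit [PartialOrder A] [StarOrderedRing A] in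
/-- If the range of `V` is invariant under `ρ(S)`, then it reduces `ρ(C⋆(S))`. -/
theorem exists_subrep (hS : IsOperatorSystem S) (ρ : A →⋆ₐ[ℂ] (L →L[ℂ] L)) (V : M →ₗᵢ[ℂ] L)
    {ψ : S → M → M} (hV : ∀ (s : S) x, ρ s (V x) = V (ψ s x)) :
    ∃ π : cstarGenerated S →⋆ₐ[ℂ] (M →L[ℂ] M),
      ∀ a x y, ⟪x, π a y⟫_ℂ = ⟪V x, ρ a (V y)⟫_ℂ := by
  set V' := V.toContinuousLinearMap with hV'
  have hVV : ∀ x, ContinuousLinearMap.adjoint V' (V' x) = x := fun x =>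
    ext_inner_left ℂ fun y => by
      rw [ContinuousLinearMap.adjoint_inner_right]; exact V.inner_map_map y x
  let P : L →L[ℂ] L := V' ∘L ContinuousLinearMap.adjoint V'
  have hPstar : star P = P := by
    simp [P, ContinuousLinearMap.star_eq_adjoint, ContinuousLinearMap.adjoint_comp]
  have hPρP : ∀ s : S, P * ρ s * P = ρ s * P := fun s => ContinuousLinearMap.ext fun y => by
    change P (ρ s (V (ContinuousLinearMap.adjoint V' y))) = ρ s (V _)
    rw [hV]
    change V' (ContinuousLinearMap.adjoint V' (V' _)) = _
    rw [hVV]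
    exact (hV _ _).symm
  have hPρ : ∀ s : S, P * ρ s = ρ s * P := fun s => by
    have h := congrArg star (hPρP (hS.star s))
    simp only [star_mul, hPstar, ← map_star, IsOperatorSystem.star, star_star] at h
    rw [← h, ← mul_assoc, hPρP]
  have hle : StarAlgebra.adjoin ℂ (S : Set A) ≤
      (StarSubalgebra.centralizer ℂ {P}).comap ρ := by
    refine StarAlgebra.adjoin_le fun s hs => ?_
    rw [SetLike.mem_coe, StarSubalgebra.mem_comap, StarSubalgebra.mem_centralizer_iff]
    rintro _ rfl
    rw [hPstar]
    exact ⟨hPρ ⟨s, hs⟩, hPρ ⟨s, hs⟩⟩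
  have hcont : Continuous ρ := map_continuous ρ
  have hcomm : ∀ a ∈ cstarGenerated S, P * ρ a = ρ a * P := by
    intro a ha
    have hclosed : IsClosed {a : A | P * ρ a = ρ a * P} :=
      isClosed_eq (by fun_prop) (by fun_prop)
    refine closure_minimal (fun b hb => ?_) hclosed ha
    have := hle hb
    rw [StarSubalgebra.mem_comap, StarSubalgebra.mem_centralizer_iff] at this
    exact (this P rfl).1
  have hfix : ∀ a ∈ cstarGenerated S, ∀ x,
      V' (ContinuousLinearMap.adjoint V' (ρ a (V' x))) = ρ a (V' x) := fun a ha x => by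
    have := congrArg (fun T : L →L[ℂ] L => T (V' x)) (hcomm a ha)
    change V' (ContinuousLinearMap.adjoint V' (ρ a (V' x)))
      = ρ a (V' (ContinuousLinearMap.adjoint V' (V' x))) at this
    rwa [hVV] at this
  refine ⟨{ toFun := fun a => ContinuousLinearMap.adjoint V' ∘L ρ a ∘L V'
            map_one' := ?_
            map_mul' := ?_
            map_zero' := ?_
            map_add' := ?_
            commutes' := ?_
            map_star' := ?_ }, fun a x y => ?_⟩
  · ext x; simp [hVV]
  · intro a b
    ext x
    simp [hfix b b.2]
  · ext x; simp
  · intro a b; ext x; simp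
  · intro r; ext x; simp [Algebra.algebraMap_eq_smul_one, hVV]
  · intro a
    rw [StarMemClass.coe_star, map_star]
    simp [ContinuousLinearMap.star_eq_adjoint, ContinuousLinearMap.adjoint_comp,
      ContinuousLinearMap.comp_assoc]
  · change ⟪x, ContinuousLinearMap.adjoint V' (ρ a (V' y))⟫_ℂ = ⟪V' x, ρ a (V' y)⟫_ℂ
    rw [ContinuousLinearMap.adjoint_inner_right]

theorem IsMaximal.apply_of_isDilation {M : Type v} [NormedAddCommGroup M]
    [InnerProductSpace ℂ M] [CompleteSpace M] {ψ : S →ₗ[ℂ] (M →L[ℂ] M)} (hmax : IsMaximal ψ)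
    {K : Type v} [NormedAddCommGroup K] [InnerProductSpace ℂ K] [CompleteSpace K]
    {V : M →ₗᵢ[ℂ] K} {χ : S →ₗ[ℂ] (K →L[ℂ] K)} (h : IsDilation V ψ χ) (s : S) (x : M) :
    χ s (V x) = V (ψ s x) := by
  obtain ⟨ψ', hψ'⟩ := hmax K V χ h
  have h0 := hψ' s x 0
  rwa [map_zero, Submodule.coe_zero, add_zero, add_zero] at h0

theorem isDilation_of_inner {H : Type v} [NormedAddCommGroup H] [InnerProductSpace ℂ H]
    [CompleteSpace H] {K : Type*} [NormedAddCommGroup K] [InnerProductSpace ℂ K]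
    [CompleteSpace K] {V : H →ₗᵢ[ℂ] K} {φ : S →ₗ[ℂ] (H →L[ℂ] H)} {ψ : S →ₗ[ℂ] (K →L[ℂ] K)}
    (hψ : IsUCP ψ) (h : ∀ s x y, ⟪V x, ψ s (V y)⟫_ℂ = ⟪x, φ s y⟫_ℂ) : IsDilation V φ ψ :=
  ⟨hψ, fun s => ContinuousLinearMap.ext fun y => ext_inner_left ℂ fun x => by
    rw [← h, ContinuousLinearMap.comp_apply, ContinuousLinearMap.comp_apply,
      ContinuousLinearMap.adjoint_inner_right, V.coe_toContinuousLinearMap]⟩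

omit [PartialOrder A] [StarOrderedRing A] in
theorem isOperatorSystem_cstarSubspace : IsOperatorSystem (cstarSubspace S) where
  one_mem := one_mem (cstarGenerated S)
  star_mem _ ha := star_mem (S := StarSubalgebra ℂ A) (s := cstarGenerated S) ha
  isClosed := StarSubalgebra.isClosed_topologicalClosure _

omit [PartialOrder A] [StarOrderedRing A] in
theorem starAlgHom_cstarGenerated_ext {π π' : cstarGenerated S →⋆ₐ[ℂ] (M →L[ℂ] M)}
    (h : ∀ (a : A) (ha : a ∈ S), π ⟨a, subset_cstarGenerated S ha⟩
      = π' ⟨a, subset_cstarGenerated S ha⟩) : π = π' := by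
  have : IsClosed (cstarGenerated S : Set A) := StarSubalgebra.isClosed_topologicalClosure _
  have hc : ∀ π : cstarGenerated S →⋆ₐ[ℂ] (M →L[ℂ] M), Continuous π := fun π =>
    map_continuous π
  refine StarAlgHom.ext_topologicalClosure (hc π) (hc π') ?_
  exact StarAlgHom.ext_adjoin fun x hx => h x hx

/-- A pure maximal u.c.p. map extends to a boundary representation. -/
theorem exists_boundaryRep {M : Type (max u v)} [NormedAddCommGroup M] [InnerProductSpace ℂ M]
    [CompleteSpace M] [Nontrivial M] (hS : IsOperatorSystem S) {ψ : S →ₗ[ℂ] (M →L[ℂ] M)}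
    (hpure : IsPure ψ) (hone : ψ hS.one = 1) (hmax : IsMaximal ψ) :
    ∃ π : cstarGenerated S →⋆ₐ[ℂ] (M →L[ℂ] M),
      (∀ (a : A) (ha : a ∈ S), π ⟨a, subset_cstarGenerated S ha⟩ = ψ ⟨a, ha⟩) ∧
      IsBoundaryRep S π := by
  -- Used for `T = S`, to construct `π`, and for `T = C⋆(S)`, to show that a competing `θ` is
  -- multiplicative. As `M` lies in `Type (max u v)`, the Stinespring space lies in the same
  -- universe, as `IsMaximal` requires.
  have hext : ∀ (T : Submodule ℂ A) (hT : IsOperatorSystem T) (hST : S ≤ T)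
      (θ : T →ₗ[ℂ] (M →L[ℂ] M)), IsCP θ → θ hT.one = 1 →
      (∀ s : S, θ ⟨s, hST s.2⟩ = ψ s) →
      ∃ π : cstarGenerated S →⋆ₐ[ℂ] (M →L[ℂ] M),
        ∀ (a : cstarGenerated S) (ha : (a : A) ∈ T), π a = θ ⟨a, ha⟩ := by
    intro T hT hST θ hθ hθ1 hθψ
    obtain ⟨L, _, _, _, V, ρ, hρ⟩ := exists_stinespring hT hθ hθ1
    have hdil : IsDilation V ψ (ρ.toAlgHom.toLinearMap ∘ₗ S.subtype) := by
      refine isDilation_of_inner ⟨isCP_restrict ρ, hS.one_mem, map_one ρ⟩ fun s x y => ?_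
      rw [← hθψ]
      exact hρ ⟨s, hST s.2⟩ x y
    obtain ⟨π, hπ⟩ := exists_subrep hS ρ V (ψ := fun s x => ψ s x)
      fun s x => hmax.apply_of_isDilation hdil s x
    exact ⟨π, fun a ha => ContinuousLinearMap.ext fun y => ext_inner_left ℂ fun x => by
      rw [hπ]; exact hρ ⟨a, ha⟩ x y⟩
  obtain ⟨π, hπ⟩ := hext S hS le_rfl ψ hpure.1 hone fun s => rfl
  have hπS : ∀ (a : A) (ha : a ∈ S), π ⟨a, subset_cstarGenerated S ha⟩ = ψ ⟨a, ha⟩ :=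
    fun a ha => hπ ⟨a, subset_cstarGenerated S ha⟩ ha
  refine ⟨π, hπS, ⟨inferInstance, fun N hN hinv => ?_⟩, fun θ hθ hθS a ha => ?_⟩
  · refine hpure.eq_bot_or_eq_top hS hone N hN fun s x hx => ?_
    rw [← hπS s s.2]
    exact hinv _ x hx
  · obtain ⟨h1, hθ1⟩ := hθ.2
    obtain ⟨π', hπ'⟩ := hext (cstarSubspace S) isOperatorSystem_cstarSubspace
      (fun a ha => subset_cstarGenerated S ha) θ hθ.1 hθ1 fun s => by
        rw [← hπS s s.2]; exact hθS s s.2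
    have : π = π' := starAlgHom_cstarGenerated_ext fun a ha => by
      rw [hπ' _ (subset_cstarGenerated S ha)]; exact (hθS a ha).symm
    rw [this]
    exact (hπ' ⟨a, ha⟩ ha).symm

end Subrep

/-! ### Maximality and its failure. -/

section Maximal

variable {A : Type u} [CStarAlgebra A] [PartialOrder A] [StarOrderedRing A]
  {S : Submodule ℂ A}

/-- Invariance of `H` suffices: c.p. maps respect adjoints, so `Hᗮ` is invariant too. -/
theorem isMaximal_of_invariant (hS : IsOperatorSystem S) {H : Type v} [NormedAddCommGroup H]
    [InnerProductSpace ℂ H] [CompleteSpace H] {φ : S →ₗ[ℂ] (H →L[ℂ] H)}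
    (h : ∀ (K : Type v) [NormedAddCommGroup K] [InnerProductSpace ℂ K] [CompleteSpace K]
      (V : H →ₗᵢ[ℂ] K) (χ : S →ₗ[ℂ] (K →L[ℂ] K)), IsDilation V φ χ →
      ∀ s x, χ s (V x) = V (φ s x)) : IsMaximal φ := by
  intro K _ _ _ V χ hχ
  set N := (LinearMap.range V.toLinearMap)ᗮ with hN
  have hinv : ∀ s, ∀ y ∈ N, χ s y ∈ N := by
    intro s y hy
    rw [hN, Submodule.mem_orthogonal] at hy ⊢
    rintro _ ⟨x, rfl⟩
    refine (starRingEnd ℂ).injective ?_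
    change starRingEnd ℂ ⟪V x, χ s y⟫_ℂ = _
    rw [← hχ.1.1.inner_star hS, h K V χ hχ, ← inner_conj_symm]
    exact congrArg _ (hy _ ⟨φ (hS.star s) x, rfl⟩)
  refine ⟨compress N.subtypeL χ, fun s x y => ?_⟩
  rw [map_add, h K V χ hχ]
  congr 1
  have h1 : compress N.subtypeL χ s y = ⟨χ s y, hinv s y y.2⟩ := ext_inner_left ℂ fun z => by
    rw [inner_compress]; rfl
  rw [h1]

/-- Failure of maximality yields a nontrivial dilation by one dimension inside a larger space. -/
theorem exists_nontrivial_oneStepDilation (hS : IsOperatorSystem S)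
    {L : Type*} [NormedAddCommGroup L] [InnerProductSpace ℂ L] [CompleteSpace L]
    {M : Type*} [NormedAddCommGroup M] [InnerProductSpace ℂ M] [CompleteSpace M]
    {K : Type*} [NormedAddCommGroup K] [InnerProductSpace ℂ K] [CompleteSpace K]
    {ψ : S →ₗ[ℂ] (L →L[ℂ] L)} (hψ : IsCP ψ)
    (hidem : ∀ x, ψ hS.one (ψ hS.one x) = ψ hS.one x) {e : L} (he : ‖e‖ = 1)
    (hpe : ψ hS.one e = 0) {ι : M →ₗᵢ[ℂ] L}
    (hι : ∀ x, ι (ContinuousLinearMap.adjoint ι.toContinuousLinearMap x) = ψ hS.one x)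
    (V : M →ₗᵢ[ℂ] K) {χ : S →ₗ[ℂ] (K →L[ℂ] K)} (hχ : IsCP χ) (hχ1 : χ hS.one = 1)
    (hχψ : ∀ s x y, ⟪V x, χ s (V y)⟫_ℂ = ⟪ι x, ψ s (ι y)⟫_ℂ) (s₀ : S) (x₀ : M)
    (hne : ∀ y, χ s₀ (V x₀) ≠ V y) :
    ∃ χ₀ ∈ oneStepDilations hS ψ e, 0 < (⟪e, χ₀ s₀ (ι x₀)⟫_ℂ).re := by
  set ι' := ContinuousLinearMap.adjoint ι.toContinuousLinearMap with hι'
  set V' := ContinuousLinearMap.adjoint V.toContinuousLinearMap with hV'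
  have hι'inner : ∀ x y, ⟪ι' x, y⟫_ℂ = ⟪x, ι y⟫_ℂ := fun x y =>
    ContinuousLinearMap.adjoint_inner_left ι.toContinuousLinearMap y x
  have hV'inner : ∀ x y, ⟪V' x, y⟫_ℂ = ⟪x, V y⟫_ℂ := fun x y =>
    ContinuousLinearMap.adjoint_inner_left V.toContinuousLinearMap y x
  have hι'ι : ∀ x, ι' (ι x) = x := fun x => ext_inner_right ℂ fun y => by
    rw [hι'inner, ι.inner_map_map]
  have hV'V : ∀ x, V' (V x) = x := fun x => ext_inner_right ℂ fun y => by
    rw [hV'inner, V.inner_map_map]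
  set z := χ s₀ (V x₀) with hz
  set r := z - V (V' z) with hr
  have hr0 : r ≠ 0 := sub_ne_zero.mpr (hne _)
  have hrV : ∀ y, ⟪r, V y⟫_ℂ = 0 := fun y => by
    rw [hr, inner_sub_left, V.inner_map_map, hV'inner, sub_self]
  set e' : K := ((‖r‖⁻¹ : ℝ) : ℂ) • r with he'
  have he'1 : ⟪e', e'⟫_ℂ = 1 := by
    have : (‖r‖ : ℂ) ≠ 0 := by exact_mod_cast norm_ne_zero_iff.mpr hr0
    rw [he', inner_smul_left, inner_smul_right, inner_self_eq_norm_sq_to_K, Complex.conj_ofReal]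
    simp
    field_simp
  have he'V : ∀ y, ⟪e', V y⟫_ℂ = 0 := fun y => by
    rw [he', inner_smul_left, hrV, mul_zero]
  have he'V' : ∀ y, ⟪V y, e'⟫_ℂ = 0 := fun y => by
    rw [← inner_conj_symm, he'V, map_zero]
  -- `W` carries the copy of `M` in `L` to its copy in `K`, and `e` to the direction `e'` in which
  -- `χ(s₀)Vx₀` leaves that copy. The resulting coefficient is `‖r‖ > 0`.
  let W : L →L[ℂ] K := V.toContinuousLinearMap ∘L ι' + InnerProductSpace.rankOne ℂ e' e
  have hW : ∀ x, W x = V (ι' x) + ⟪e, x⟫_ℂ • e' := fun x => by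
    simp [W, InnerProductSpace.rankOne_apply]
  have hex : ∀ x, ⟪e, ψ hS.one x⟫_ℂ = 0 := fun x => by
    rw [← hψ.one_symm hS, hpe, inner_zero_left]
  have hι'p : ∀ x, ι' (ψ hS.one x) = ι' x := fun x => by rw [← hι, hι'ι]
  refine ⟨compress W χ, ⟨hχ.compress W, fun y => ext_inner_left ℂ fun x => ?_,
    ext_inner_form fun s x y => ?_⟩, ?_⟩
  · rw [inner_compress, hχ1, one_apply_eq_self, hW, hW]
    simp only [inner_add_left, inner_add_right, inner_smul_left, inner_smul_right, he'V, he'V',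
      he'1, V.inner_map_map, mul_zero, add_zero, zero_add, mul_one]
    rw [hι'inner, hι, inner_conj_symm, mul_comm]
  · have h1 : ∀ x, W (ψ hS.one x) = V (ι' x) := fun x => by
      rw [hW, hex, zero_smul, add_zero, hι'p]
    rw [inner_compress, inner_compress, h1, h1, hχψ, hι, hι, ← inner_compress,
      hψ.compress_one_self hS hidem]
  · have h1 : W (ι x₀) = V x₀ := by
      have : ψ hS.one (ι x₀) = ι x₀ := by rw [← hι, hι'ι]
      rw [hW, hι'ι, ← this, hex, zero_smul, add_zero]
    have h2 : W e = e' := by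
      have : ι' e = 0 := by rw [← hι'p, hpe, map_zero]
      rw [hW, this, map_zero, zero_add, inner_self_eq_norm_sq_to_K, he]
      simp
    have h3 : ⟪r, z⟫_ℂ = ((‖r‖ ^ 2 : ℝ) : ℂ) := by
      have : z = r + V (V' z) := by rw [hr]; abel
      rw [this, inner_add_right, hrV, add_zero, inner_self_eq_norm_sq_to_K]
      simp
    rw [inner_compress, h1, h2, ← hz, he', inner_smul_left, Complex.conj_ofReal, h3,
      ← Complex.ofReal_mul, Complex.ofReal_re]
    have := norm_pos_iff.mpr hr0
    positivity

end Maximal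

/-! ### The ambient Hilbert space. -/

section Ambient

/-- Every Hilbert space embeds in one containing a prescribed number of orthonormal vectors. -/
theorem exists_ambient (H : Type v) [NormedAddCommGroup H] [InnerProductSpace ℂ H]
    [CompleteSpace H] (I : Type (max u v)) :
    ∃ (L : Type (max u v)) (_ : NormedAddCommGroup L) (_ : InnerProductSpace ℂ L)
      (_ : CompleteSpace L) (_ : H →ₗᵢ[ℂ] L) (e : I → L), Orthonormal ℂ e := by
  let b : HilbertBasis I ℂ (lp (fun _ : I => ℂ) 2) :=
    HilbertBasis.ofRepr (LinearIsometryEquiv.refl ℂ _)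
  obtain ⟨J, -⟩ := exists_linearIsometry_of_inner
    (fun x : H => WithLp.toLp 2 ((x, 0) : H × lp (fun _ : I => ℂ) 2))
    (fun x y => by simp [WithLp.prod_inner_apply])
  refine ⟨WithLp 2 (H × lp (fun _ : I => ℂ) 2), inferInstance, inferInstance, inferInstance, J,
    fun i => WithLp.toLp 2 (0, b i), ?_⟩
  classical
  rw [orthonormal_iff_ite]
  intro i j
  have := orthonormal_iff_ite.mp b.orthonormal i j
  simpa [WithLp.prod_inner_apply] using this

end Ambient

/-! ### Assembly of the proof. -/

theorem theorem2p4 {A : Type u} [CStarAlgebra A] [PartialOrder A] [StarOrderedRing A]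
    (S : Submodule ℂ A) (hS : IsOperatorSystem S)
    {H : Type v} [NormedAddCommGroup H] [InnerProductSpace ℂ H] [CompleteSpace H] [Nontrivial H]
    (φ : S →ₗ[ℂ] (H →L[ℂ] H)) (hucp : IsUCP φ) (hpure : IsPure φ) :
    ∃ (K : Type (max u v)) (_ : NormedAddCommGroup K) (_ : InnerProductSpace ℂ K)
      (_ : CompleteSpace K) (V : H →ₗᵢ[ℂ] K) (ψ : S →ₗ[ℂ] (K →L[ℂ] K)),
      IsDilation V φ ψ ∧ IsPure ψ ∧ IsMaximal ψ ∧
      ∃ π : cstarGenerated S →⋆ₐ[ℂ] (K →L[ℂ] K),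
        (∀ (a : A) (ha : a ∈ S), π ⟨a, subset_cstarGenerated S ha⟩ = ψ ⟨a, ha⟩) ∧
        IsBoundaryRep S π := by
  -- The power set as index set makes `L` too large for the cyclic subspace generated from `H` to be
  -- dense.
  obtain ⟨L, _, _, _, J, b, hb⟩ := exists_ambient.{u, v} H
    (Set (TensorProduct ℂ (FreeAlgebra ℂ S) H))
  have hφ1 : φ hS.one = 1 := hucp.2.2
  set J' := ContinuousLinearMap.adjoint J.toContinuousLinearMap with hJ'
  have hJ'inner : ∀ x y, ⟪J' x, y⟫_ℂ = ⟪x, J y⟫_ℂ := fun x y =>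
    ContinuousLinearMap.adjoint_inner_left J.toContinuousLinearMap y x
  have hJ'J : ∀ x, J' (J x) = x := fun x => ext_inner_right ℂ fun y => by
    rw [hJ'inner, J.inner_map_map]
  obtain ⟨h₀, hh₀⟩ := exists_ne (0 : H)
  set φ₀ := compress J' φ with hφ₀
  have hφ₀inner : ∀ s x y, ⟪J x, φ₀ s (J y)⟫_ℂ = ⟪x, φ s y⟫_ℂ := fun s x y => by
    rw [hφ₀, inner_compress, hJ'J, hJ'J]
  have hφ₀one : ∀ x, φ₀ hS.one x = J (J' x) := fun x => ext_inner_left ℂ fun y => by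
    rw [hφ₀, inner_compress, hφ1, one_apply_eq_self, hJ'inner]
  have hφ₀pure : IsPure φ₀ := hpure.compress_adjoint hS hJ'J
  have hφ₀idem : ∀ x, φ₀ hS.one (φ₀ hS.one x) = φ₀ hS.one x := fun x => by
    rw [hφ₀one, hφ₀one, hJ'J]
  have hφ₀ne : φ₀ ≠ 0 := fun h => by
    have h1 := hφ₀one (J h₀)
    rw [h, hJ'J] at h1
    exact hh₀ (J.injective (by simpa using h1.symm))
  obtain ⟨ψ, hψ, hidem, hψφ, hψmax⟩ := exists_maximal_pure (hS := hS) hφ₀pure hφ₀ne hφ₀idem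
  have hψJ : ∀ x, ψ hS.one (J x) = J x := fun x => by
    have := one_apply_one_of_compress hφ₀pure.1 hψ.1 hφ₀idem hidem hψφ (J x)
    rwa [hφ₀one, hJ'J] at this
  have hψJinner : ∀ s x y, ⟪J x, ψ s (J y)⟫_ℂ = ⟪x, φ s y⟫_ℂ := fun s x y => by
    have := inner_compress (φ₀ hS.one) ψ s (J x) (J y)
    rw [hψφ, hφ₀inner, hφ₀one, hφ₀one, hJ'J, hJ'J] at this
    exact this.symm
  have hne1 : ψ hS.one ≠ 1 := fun h => by
    obtain ⟨Θ, hΘ⟩ := hψ.denseRange hS h J.toLinearMap (h := h₀)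
      (fun h => hh₀ (J.injective (by simpa using h)))
    exact not_denseRange_of_orthonormal hb Θ hΘ
  obtain ⟨e, he, hpe⟩ : ∃ e : L, ‖e‖ = 1 ∧ ψ hS.one e = 0 := by
    obtain ⟨x, hx⟩ := DFunLike.ne_iff.mp hne1
    have hx' : x - ψ hS.one x ≠ 0 := fun h => hx (sub_eq_zero.mp h).symm
    refine ⟨((‖x - ψ hS.one x‖⁻¹ : ℝ) : ℂ) • (x - ψ hS.one x), ?_, ?_⟩
    · rw [norm_smul, Complex.norm_real, norm_inv, norm_norm,
        inv_mul_cancel₀ (norm_ne_zero_iff.mpr hx')]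
    · rw [map_smul, map_sub, hidem, sub_self, smul_zero]
  let M : Submodule ℂ L := LinearMap.eqLocus (ψ hS.one : L →ₗ[ℂ] L) LinearMap.id
  have hM : ∀ x, x ∈ M ↔ ψ hS.one x = x := fun x => Iff.rfl
  have hMclosed : IsClosed (M : Set L) := isClosed_eq (ψ hS.one).continuous continuous_id
  have : CompleteSpace M := hMclosed.completeSpace_coe
  let ι : M →ₗᵢ[ℂ] L := M.subtypeₗᵢ
  set ι' := ContinuousLinearMap.adjoint ι.toContinuousLinearMap with hι'
  have hι'inner : ∀ x y, ⟪ι' x, y⟫_ℂ = ⟪x, ι y⟫_ℂ := fun x y =>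
    ContinuousLinearMap.adjoint_inner_left ι.toContinuousLinearMap y x
  have hι'ι : ∀ x, ι' (ι x) = x := fun x => ext_inner_right ℂ fun y => by
    rw [hι'inner, ι.inner_map_map]
  have hι : ∀ x, ι (ι' x) = ψ hS.one x := fun x => by
    have : ι' x = ⟨ψ hS.one x, (hM _).mpr (hidem x)⟩ := ext_inner_right ℂ fun y => by
      rw [hι'inner, Submodule.coe_inner, hψ.1.one_symm hS, (hM _).mp y.2]
      rfl
    rw [this]
    rfl
  set ψM := compress ι.toContinuousLinearMap ψ with hψM
  have hψMinner : ∀ s x y, ⟪x, ψM s y⟫_ℂ = ⟪ι x, ψ s (ι y)⟫_ℂ := fun s x y =>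
    inner_compress _ _ _ _ _
  have hψM1 : ψM hS.one = 1 := ContinuousLinearMap.ext fun y => ext_inner_left ℂ fun x => by
    have hy : ψ hS.one (ι y) = ι y := (hM _).mp y.2
    rw [hψMinner, one_apply_eq_self, hy, ι.inner_map_map]
  have hψMpure : IsPure ψM := hψ.compress_of_compress_self hι'ι (by
    have : ι.toContinuousLinearMap ∘L ι' = ψ hS.one := ContinuousLinearMap.ext hι
    rw [this, hψ.1.compress_one_self hS hidem])
  obtain ⟨V, hV⟩ := exists_linearIsometry_of_inner
    (fun x : H => (⟨J x, (hM _).mpr (hψJ x)⟩ : M)) (fun x y => J.inner_map_map x y)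
  have hιV : ∀ x, ι (V x) = J x := fun x => by rw [hV]; rfl
  have hmax : IsMaximal ψM := by
    refine isMaximal_of_invariant hS fun K _ _ _ W χ hχ s x => ?_
    have hχψ : ∀ s x y, ⟪W x, χ s (W y)⟫_ℂ = ⟪ι x, ψ s (ι y)⟫_ℂ := fun s x y => by
      rw [← hψMinner, ← hχ.2 s]
      exact (ContinuousLinearMap.adjoint_inner_right W.toContinuousLinearMap _ _).symm
    by_cases hex : ∃ y, χ s (W x) = W y
    · obtain ⟨y, hy⟩ := hex
      rw [hy]
      congr 1
      refine ext_inner_left ℂ fun z => ?_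
      rw [hψMinner, ← hχψ, hy, W.inner_map_map]
    · push Not at hex
      obtain ⟨χ₀, hχ₀, hpos⟩ := exists_nontrivial_oneStepDilation hS hψ.1 hidem he hpe hι W
        hχ.1.1 hχ.1.2.2 hχψ s x hex
      obtain ⟨ξ, hξ, hξpure⟩ := exists_pure_oneStepDilation hψ hidem he hpe hχ₀
        ((hM _).mp x.2) hpos
      have hξ1 := hξ.2.1
      have hee : ⟪e, e⟫_ℂ = 1 := by rw [inner_self_eq_norm_sq_to_K, he]; simp
      have h1 : ∀ y, ⟪e, ψ hS.one y⟫_ℂ = 0 := fun y => by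
        rw [← hψ.1.one_symm hS, hpe, inner_zero_left]
      -- The map `ξ` is a pure dilation of `ψ` in `L`, so it equals `ψ`; yet `ξ(1)e = e` while
      -- `ψ(1)e = 0`.
      have h2 : ξ = ψ := hψmax ξ hξpure (fun y => by
        rw [hξ1 (ξ hS.one y), hξ1 y, map_add, map_smul, hidem, hpe, inner_add_right,
          inner_smul_right, h1, hee]
        simp) hξ.2.2
      have h3 := hξ1 e
      rw [h2, hpe, hee, one_smul, zero_add] at h3
      rw [← h3, norm_zero] at he
      exact absurd he zero_ne_one
  have : Nontrivial M := ⟨V h₀, 0, fun h => hh₀ (V.injective (by rw [h, map_zero]))⟩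
  refine ⟨M, inferInstance, inferInstance, inferInstance, V, ψM, ?_, hψMpure, hmax, ?_⟩
  · refine isDilation_of_inner ⟨hψMpure.1, hS.one_mem, hψM1⟩ fun s x y => ?_
    rw [hψMinner, hιV, hιV, hψJinner]
  · exact exists_boundaryRep hS hψMpure hψM1 hmax
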